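/- Let $V\in C^\infty(\mathbb R;\mathbb R)$, and suppose that there are constants $A_\pm>0$, $R>0$ and functions $F_\pm$, holomorphic near $z=0$ with $F_\pm(0)=0$, such that $V(x)=F_+(e^{-A_+x})$ for $x>R$ and $V(x)=F_-(e^{A_-x})$ for $x<-R$. For $\lambda\in\mathbb C$ let $u_\pm(x,\lambda)$ be the outgoing solutions at $\pm\infty$: $(-\partial_x^2+V(x)-\lambda^2)u_\pm(x,\lambda)=0$ on $\mathbb R$ and $$u_\pm(x,\lambda)=e^{\pm i\lambda x}\,v_\pm(e^{\mp A_\pm x},\lambda),\qquad v_\pm(0,\lambda)=\frac1{\Gamma(1-2i\lambda A_\pm^{-1})},$$ where $w\mapsto v_\pm(w,\lambda)$ is holomorphic near $w=0$ and, for every $x$, $\lambda\mapsto u_\pm(x,\lambda)$ is entire. These two families exist and are uniquely determined by these conditions. Their Wronskian $$F(\lambda)=W[u_+,u_-](\lambda)=(\partial_xu_+)(x,\lambda)\,u_-(x,\lambda)-u_+(x,\lambda)\,(\partial_xu_-)(x,\lambda)$$ does not depend on $x$, is entire in $\lambda$, and satisfies the following. 1. There is $C>0$ such that $F^{-1}(0)\subset\{iy: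 y\in[0,C]\}\cup\{z\in\mathbb C:\operatorname{Im}z<0\}$, and only finitely many zeros of $F$ satisfy $\operatorname{Im}z\ge 0$. 2. If $F(\lambda)=0$, then $F(-\bar\lambda)=0$; in fact $F(z)=\overline{F(-\bar z)}$ for all $z\in\mathbb C$. 3. There is $\delta>0$ such that $F$ has no zero in the strip $\{\lambda:-\delta<\operatorname{Im}\lambda<0\}$. 4. For every $\varepsilon>0$ there is $C>0$ such that for all $r>0$ the number of zeros of $F$ in $\{|z|\le r\}$ is at most $C(1+r^{1+\varepsilon})$, also when the zeros are counted with multiplicity. -/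

import Mathlib

open Filter
open scoped ContDiff

/-- Smooth real potentials on the line that near `±∞` are convergent power series, without constant
term, in `exp (∓ A± x)`. -/
structure IsExpAnalyticPotential (V : ℝ → ℝ) (Aplus Aminus : ℝ) : Prop where
  smooth : ContDiff ℝ ∞ V
  plus_pos : 0 < Aplus
  minus_pos : 0 < Aminus
  expansion : ∃ R > (0 : ℝ), ∃ Fplus Fminus : ℂ → ℂ,
    AnalyticAt ℂ Fplus 0 ∧ Fplus 0 = 0 ∧ AnalyticAt ℂ Fminus 0 ∧ Fminus 0 = 0 ∧
    (∀ x : ℝ, R < x → (V x : ℂ) = Fplus (Complex.exp (-(Aplus * x)))) ∧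
    (∀ x : ℝ, x < -R → (V x : ℂ) = Fminus (Complex.exp (Aminus * x)))

/-- `u` is a classical solution on the whole line of `(D_x² + V - lam²) u = 0`, where
`D_x² = -∂_x²`. -/
def SolvesSchrodinger (V : ℝ → ℝ) (lam : ℂ) (u : ℝ → ℂ) : Prop :=
  ContDiff ℝ 2 u ∧ ∀ x : ℝ, -iteratedDeriv 2 u x + (V x : ℂ) * u x = lam ^ 2 * u x

/-- `u` is outgoing at `+∞`, with `u x = exp (i lam x) v (exp (-A x))` for a profile `v` that is
holomorphic near `0` and has `v 0 = c`. The identity is required for large `x`; it then defines the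
profile at every `w = exp (-A x) > 0`, with the regularity of `u`. -/
def IsOutgoingAtTop (V : ℝ → ℝ) (A : ℝ) (lam c : ℂ) (u : ℝ → ℂ) : Prop :=
  SolvesSchrodinger V lam u ∧
    ∃ v : ℂ → ℂ, AnalyticAt ℂ v 0 ∧ v 0 = c ∧
      ∀ᶠ x : ℝ in atTop, u x = Complex.exp (Complex.I * lam * x) * v (Complex.exp (-(A * x)))

/-- `u` is outgoing at `-∞`, with `u x = exp (-i lam x) v (exp (A x))` for a profile `v` that is
holomorphic near `0` and has `v 0 = c`. -/
def IsOutgoingAtBot (V : ℝ → ℝ) (A : ℝ) (lam c : ℂ) (u : ℝ → ℂ) : Prop :=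
  SolvesSchrodinger V lam u ∧
    ∃ v : ℂ → ℂ, AnalyticAt ℂ v 0 ∧ v 0 = c ∧
      ∀ᶠ x : ℝ in atBot, u x = Complex.exp (-(Complex.I * lam * x)) * v (Complex.exp (A * x))

/-- The family `u₊ lam x` of outgoing solutions at `+∞`, normalized by
`v₊ 0 = 1 / Γ (1 - 2 i lam / A)` and entire in `lam`. (Where `2 i lam / A` is a positive integer the
normalization reads `v₊ 0 = 0`, and it is the holomorphy in `lam` that fixes the solution.) -/
structure IsOutgoingFamilyPlus (V : ℝ → ℝ) (A : ℝ) (u : ℂ → ℝ → ℂ) : Prop where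
  outgoing : ∀ lam : ℂ,
    IsOutgoingAtTop V A lam (Complex.Gamma (1 - 2 * Complex.I * lam / A))⁻¹ (u lam)
  entire : ∀ x : ℝ, Differentiable ℂ (fun lam : ℂ => u lam x)

/-- The family `u₋ lam x` of outgoing solutions at `-∞`, normalized by
`v₋ 0 = 1 / Γ (1 - 2 i lam / A)` and entire in `lam`. -/
structure IsOutgoingFamilyMinus (V : ℝ → ℝ) (A : ℝ) (u : ℂ → ℝ → ℂ) : Prop where
  outgoing : ∀ lam : ℂ,
    IsOutgoingAtBot V A lam (Complex.Gamma (1 - 2 * Complex.I * lam / A))⁻¹ (u lam)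
  entire : ∀ x : ℝ, Differentiable ℂ (fun lam : ℂ => u lam x)

/-- The Wronskian `W[u, v] = u' v - u v'` at `x`. -/
noncomputable def wronskianAt (u v : ℝ → ℂ) (x : ℝ) : ℂ := deriv u x * v x - u x * deriv v x

/-- The set of zeros of `F` in the closed disc `|z| ≤ r`. -/
def zerosInDisc (F : ℂ → ℂ) (r : ℝ) : Set ℂ := {z : ℂ | F z = 0 ∧ ‖z‖ ≤ r}

/-!
All statements concern Cauchy data at `x = 0`. Reflection `x ↦ -x` turns the family outgoing at `-∞`
into a family outgoing at `+∞` for `V (-x)`, so that only the end `+∞` has to be analysed, and the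
Wronskian becomes `F = u'(0) v(0) + u(0) v'(0)` for two families `u`, `v` outgoing at `+∞`.

*Existence.* With `mu = 2 i lam / A` the equation for the profile `∑ aₙ wⁿ`, `w = exp (-A x)`, is
the recursion `A² n (n - mu) aₙ = ∑_{m < n} f_{n-m} a_m`. The factors `n - mu` are absorbed by the
normalization `a₀ = 1 / Γ (1 - mu)`: one has `aₙ = bₙ / Γ (n + 1 - mu)` with polynomials `bₙ`, so
that `aₙ` is entire (`outgoingCoeff`). If `mu` stays away from the positive integers, then
`‖aₙ‖ ≤ sⁿ ‖a₀‖` (`norm_le_of_recursion`); the maximum principle on discs of half-integer radius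
extends this to all `mu`, with `a₀` replaced by the growth of `1 / Γ`. The series solves the
equation for large `x`, and the Cauchy problem, whose solutions are entire in `lam`
(`exists_hasDerivAt_linear_of_bounded`), continues it to the line
(`IsExpAnalyticAtTop.exists_family`).

*Uniqueness.* For `Im lam > 0` two outgoing solutions decay, hence have Wronskian `0` and are
proportional; the normalization makes them equal. The identity theorem does the rest. Uniqueness
also yields the symmetry `F lam = conj (F (-conj lam))`.

*Closed upper half-plane.* At a zero of `F` there is a solution outgoing at both ends. The flux
`u' conj u` is then monotone in its imaginary or real part and vanishes at both ends, unless
`lam² ∈ [-sup |V|, ∞)`; on the real axis its values at `±∞` have opposite signs unless `lam = 0`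
(`exists_eq_I_mul_of_outgoing`).

*Strip.* For `|Re lam|` large and `Im lam` bounded all denominators `n - mu` are large, and so
`u' + i lam u ≈ 2 i lam a₀` and `u' - i lam u = O (a₀)` at the origin
(`IsOutgoingFamilyPlus.exists_norm_amplitude_le`). This gives `F ≠ 0` at high energy, and the
remaining part of the strip is compact.

*Counting.* The bounds for `aₙ` and a Grönwall estimate in an energy norm show that `F` has order at
most one, and Jensen's inequality bounds the number of its zeros.
-/

open Set Topology MeasureTheory

/-! ### Linear differential equations with a holomorphic parameter -/

/-- Differentiation under the integral sign for integrands that are holomorphic in the parameter;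
the Cauchy estimate supplies the domination. -/
lemma differentiable_intervalIntegral_of_continuous {E : Type*} [NormedAddCommGroup E]
    [NormedSpace ℂ E] [CompleteSpace E] {f : ℂ → ℝ → E} (hf : Continuous f.uncurry)
    (hd : ∀ t, Differentiable ℂ fun z => f z t) (a b : ℝ) :
    Differentiable ℂ fun z => ∫ t in a..b, f z t := by
  intro z₀
  obtain ⟨M, hM⟩ : ∃ M, ∀ p ∈ Metric.closedBall z₀ 2 ×ˢ uIcc a b, ‖f.uncurry p‖ ≤ M :=
    ((isCompact_closedBall z₀ 2).prod isCompact_uIcc).exists_bound_of_continuousOn hf.continuousOn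
  have hsw : Continuous (Function.uncurry fun (t : ℝ) (z : ℂ) => f z t) := by
    exact hf.comp continuous_swap
  refine (intervalIntegral.hasDerivAt_integral_of_dominated_loc_of_deriv_le (𝕜 := ℂ)
    (F := fun z t => f z t) (F' := fun z t => deriv (fun w => f w t) z) (x₀ := z₀)
    (s := Metric.ball z₀ 1) (bound := fun _ => M) (Metric.ball_mem_nhds _ one_pos)
    (Eventually.of_forall fun z => ?_) ?_ ?_ (Eventually.of_forall fun t ht z hz => ?_) ?_
    (Eventually.of_forall fun t ht z hz => (hd t z).hasDerivAt)).2.differentiableAt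
  · exact (hf.comp (by fun_prop : Continuous fun t : ℝ => (z, t))).aestronglyMeasurable
  · exact (hf.comp (by fun_prop : Continuous fun t : ℝ => (z₀, t))).intervalIntegrable _ _
  · exact ((stronglyMeasurable_deriv_with_param hsw).comp_measurable
      (by fun_prop : Measurable fun t : ℝ => (t, z₀))).aestronglyMeasurable
  · have := Complex.norm_deriv_le_of_forall_mem_sphere_norm_le (c := z) (R := 1) (C := M)
      (f := fun w => f w t) one_pos (hd t).diffContOnCl fun w hw => hM (w, t) ⟨?_, ?_⟩
    · simpa using this
    · rw [Metric.mem_closedBall]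
      have := dist_triangle w z z₀
      have h1 : dist w z = 1 := hw
      have h2 : dist z z₀ < 1 := hz
      linarith
    · exact uIoc_subset_uIcc ht
  · exact intervalIntegrable_const

section Picard

variable {E : Type*} [NormedAddCommGroup E] [NormedSpace ℂ E]

/-- The `n`-th term of the Picard series of the initial value problem `y' = A z x y`,
`y x₀ = y₀ z`. -/
noncomputable def picardTerm (A : ℂ → ℝ → E →L[ℂ] E) (x₀ : ℝ) (y₀ : ℂ → E) : ℕ → ℂ → ℝ → E
  | 0 => fun z _ => y₀ z
  | n + 1 => fun z x => ∫ t in x₀..x, A z t (picardTerm A x₀ y₀ n z t)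

variable {A : ℂ → ℝ → E →L[ℂ] E} {x₀ : ℝ} {y₀ : ℂ → E}

lemma continuous_picardTerm (hA : Continuous A.uncurry) (hy : Continuous y₀) (n : ℕ) :
    Continuous (picardTerm A x₀ y₀ n).uncurry := by
  induction n with
  | zero => exact hy.comp continuous_fst
  | succ n ih =>
    have h : Continuous (Function.uncurry fun (p : ℂ × ℝ) (t : ℝ) =>
        A p.1 t (picardTerm A x₀ y₀ n p.1 t)) := by
      have h1 : Continuous fun q : (ℂ × ℝ) × ℝ => A.uncurry (q.1.1, q.2) :=
        hA.comp (by fun_prop)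
      have h2 : Continuous fun q : (ℂ × ℝ) × ℝ =>
          (picardTerm A x₀ y₀ n).uncurry (q.1.1, q.2) := ih.comp (by fun_prop)
      exact h1.clm_apply h2
    exact intervalIntegral.continuous_parametric_intervalIntegral_of_continuous h continuous_snd

lemma differentiable_picardTerm [CompleteSpace E] (hA : Continuous A.uncurry)
    (hAd : ∀ t, Differentiable ℂ fun z => A z t) (hy : Differentiable ℂ y₀) (n : ℕ) (x : ℝ) :
    Differentiable ℂ fun z => picardTerm A x₀ y₀ n z x := by
  induction n generalizing x with
  | zero => exact hy
  | succ n ih =>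
    refine differentiable_intervalIntegral_of_continuous ?_ (fun t => ?_) x₀ x
    · exact hA.clm_apply (continuous_picardTerm hA hy.continuous n)
    · exact (hAd t).clm_apply (ih t)

lemma norm_picardTerm_le {K : ℝ} {z : ℂ}
    (hK : ∀ t, ‖A z t‖ ≤ K) (n : ℕ) (x : ℝ) :
    ‖picardTerm A x₀ y₀ n z x‖ ≤ ‖y₀ z‖ * ((K * |x - x₀|) ^ n / n.factorial) := by
  have hK0 : 0 ≤ K := (norm_nonneg _).trans (hK 0)
  induction n generalizing x with
  | zero => simp [picardTerm]
  | succ n ih =>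
    have key : ∀ t, ‖A z t (picardTerm A x₀ y₀ n z t)‖ ≤
        K * (‖y₀ z‖ * ((K * |t - x₀|) ^ n / n.factorial)) := fun t =>
      ((A z t).le_of_opNorm_le (hK t) _).trans (mul_le_mul_of_nonneg_left (ih t) hK0)
    have hint : |∫ t in x₀..x, |t - x₀| ^ n| = |x - x₀| ^ (n + 1) / (n + 1) := by
      rcases le_total x₀ x with h | h
      · have : ∫ t in x₀..x, |t - x₀| ^ n = ∫ t in x₀..x, (t - x₀) ^ n := by
          refine intervalIntegral.integral_congr fun t ht => ?_
          rw [uIcc_of_le h] at ht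
          simp only [abs_of_nonneg (sub_nonneg.2 ht.1)]
        rw [this, intervalIntegral.integral_comp_sub_right (fun t => t ^ n), integral_pow,
          abs_of_nonneg (sub_nonneg.2 h)]
        have : (0 : ℝ) ≤ x - x₀ := sub_nonneg.2 h
        simp only [sub_self, ne_eq, Nat.add_eq_zero_iff, one_ne_zero, and_false,
          not_false_eq_true, zero_pow, sub_zero]
        exact abs_of_nonneg (by positivity)
      · have : ∫ t in x₀..x, |t - x₀| ^ n = ∫ t in x₀..x, (x₀ - t) ^ n := by
          refine intervalIntegral.integral_congr fun t ht => ?_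
          rw [uIcc_of_ge h] at ht
          simp only [abs_sub_comm t x₀, abs_of_nonneg (sub_nonneg.2 ht.2)]
        rw [this, intervalIntegral.integral_comp_sub_left (fun t => t ^ n), integral_pow,
          abs_sub_comm x x₀, abs_of_nonneg (sub_nonneg.2 h)]
        have : (0 : ℝ) ≤ x₀ - x := sub_nonneg.2 h
        simp only [sub_self, ne_eq, Nat.add_eq_zero_iff, one_ne_zero, and_false,
          not_false_eq_true, zero_pow, zero_sub, neg_div, abs_neg]
        exact abs_of_nonneg (by positivity)
    calc ‖picardTerm A x₀ y₀ (n + 1) z x‖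
        ≤ |∫ t in x₀..x, K * (‖y₀ z‖ * ((K * |t - x₀|) ^ n / n.factorial))| := by
          refine intervalIntegral.norm_integral_le_abs_of_norm_le
            (Eventually.of_forall fun t => key t) ?_
          exact Continuous.intervalIntegrable (by fun_prop) _ _
      _ = |(K ^ (n + 1) * ‖y₀ z‖ / n.factorial) * ∫ t in x₀..x, |t - x₀| ^ n| := by
          rw [← intervalIntegral.integral_const_mul]
          congr 2
          ext t
          rw [mul_pow]; ring
      _ = ‖y₀ z‖ * ((K * |x - x₀|) ^ (n + 1) / (n + 1).factorial) := by
          rw [abs_mul, hint, abs_of_nonneg (by positivity), Nat.factorial_succ, mul_pow]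
          push_cast
          field_simp

lemma picardTerm_succ_apply (n : ℕ) (z : ℂ) (x : ℝ) :
    picardTerm A x₀ y₀ (n + 1) z x = ∫ t in x₀..x, A z t (picardTerm A x₀ y₀ n z t) := rfl

lemma hasDerivAt_picardTerm_succ [CompleteSpace E] (hA : Continuous A.uncurry)
    (hy : Continuous y₀) (n : ℕ) (z : ℂ) (x : ℝ) :
    HasDerivAt (fun t => picardTerm A x₀ y₀ (n + 1) z t) (A z x (picardTerm A x₀ y₀ n z x)) x := by
  have hc : Continuous fun t => A z t (picardTerm A x₀ y₀ n z t) :=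
    (hA.comp (by fun_prop : Continuous fun t : ℝ => (z, t))).clm_apply
      ((continuous_picardTerm hA hy n).comp (by fun_prop : Continuous fun t : ℝ => (z, t)))
  simp_rw [picardTerm_succ_apply]
  exact intervalIntegral.integral_hasDerivAt_right (hc.intervalIntegrable _ _)
    (hc.stronglyMeasurableAtFilter _ _) hc.continuousAt

lemma hasDerivAt_tsum_of_norm_le_pow_div_factorial [CompleteSpace E] {g : ℕ → ℝ → E}
    {L : ℝ → E →L[ℂ] E} {M K : ℝ} (h0 : ∀ x, g 0 x = g 0 x₀)
    (hd : ∀ n x, HasDerivAt (g (n + 1)) (L x (g n x)) x) (hL : ∀ x, ‖L x‖ ≤ K) (hM : 0 ≤ M)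
    (hg : ∀ n x, ‖g n x‖ ≤ M * ((K * |x - x₀|) ^ n / n.factorial)) (x : ℝ) :
    HasDerivAt (fun x => ∑' n, g n x) (L x (∑' n, g n x)) x := by
  have hK0 : 0 ≤ K := (norm_nonneg _).trans (hL 0)
  have hfac : ∀ c : ℝ, Summable fun n : ℕ => c ^ n / n.factorial := Real.summable_pow_div_factorial
  have hsum : ∀ x, Summable fun n => g n x := fun x =>
    Summable.of_norm_bounded ((hfac (K * |x - x₀|)).mul_left M) fun n => hg n x
  obtain ⟨r, hr⟩ : ∃ r, r = |x - x₀| + 1 := ⟨_, rfl⟩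
  have hr0 : 0 < r := by rw [hr]; positivity
  have hder : HasDerivAt (fun x => ∑' n, g (n + 1) x) (∑' n, L x (g n x)) x := by
    refine hasDerivAt_tsum_of_isPreconnected (t := Metric.ball x₀ r)
      (g := fun n x => g (n + 1) x) (g' := fun n x => L x (g n x))
      (u := fun n => K * (M * ((K * r) ^ n / n.factorial)))
      (((hfac (K * r)).mul_left _).mul_left _) Metric.isOpen_ball
      (convex_ball x₀ r).isPreconnected (fun n t _ => hd n t) (fun n t ht => ?_) (y₀ := x₀)
      (Metric.mem_ball_self hr0) ((summable_nat_add_iff 1).2 (hsum x₀)) ?_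
    · refine ((L t).le_of_opNorm_le (hL t) _).trans (mul_le_mul_of_nonneg_left
        ((hg n t).trans ?_) hK0)
      have : |t - x₀| ≤ r := by
        have := Metric.mem_ball.1 ht
        rw [Real.dist_eq] at this
        exact this.le
      gcongr
    · rw [Metric.mem_ball, Real.dist_eq]
      linarith
  have heq : (fun x => ∑' n, g n x) = fun x => g 0 x₀ + ∑' n, g (n + 1) x := by
    ext x
    rw [(hsum x).tsum_eq_zero_add, h0]
  rw [(L x).map_tsum (hsum x), heq]
  exact hder.const_add _

/-- Initial value problems for linear equations `y' = A z x y` with coefficients holomorphic in `z`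
and bounded in `x` have global solutions, holomorphic in `z`. -/
theorem exists_hasDerivAt_linear_of_bounded [CompleteSpace E] (hA : Continuous A.uncurry)
    (hAd : ∀ t, Differentiable ℂ fun z => A z t) (hy : Differentiable ℂ y₀)
    (hK : ∀ r : ℝ, ∃ K : ℝ, ∀ z, ‖z‖ ≤ r → ∀ t, ‖A z t‖ ≤ K) :
    ∃ y : ℂ → ℝ → E, (∀ z, y z x₀ = y₀ z) ∧ (∀ z x, HasDerivAt (y z) (A z x (y z x)) x) ∧
      ∀ x, Differentiable ℂ fun z => y z x := by
  have hfac : ∀ c : ℝ, Summable fun n : ℕ => c ^ n / n.factorial := Real.summable_pow_div_factorial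
  have hsum : ∀ z x, Summable fun n => picardTerm A x₀ y₀ n z x := fun z x => by
    obtain ⟨K, hK⟩ := hK ‖z‖
    exact Summable.of_norm_bounded ((hfac (K * |x - x₀|)).mul_left ‖y₀ z‖)
      fun n => norm_picardTerm_le (hK z le_rfl) n x
  refine ⟨fun z x => ∑' n, picardTerm A x₀ y₀ n z x, fun z => ?_, fun z x => ?_, fun x => ?_⟩
  · beta_reduce
    rw [tsum_eq_single 0]
    · rfl
    · intro n hn
      obtain ⟨m, rfl⟩ := Nat.exists_eq_succ_of_ne_zero hn
      simp [picardTerm]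
  · obtain ⟨K, hK⟩ := hK ‖z‖
    have hK := hK z le_rfl
    exact hasDerivAt_tsum_of_norm_le_pow_div_factorial (x₀ := x₀) (fun _ => rfl)
      (fun n x => hasDerivAt_picardTerm_succ hA hy.continuous n z x) hK (norm_nonneg (y₀ z))
      (fun n x => norm_picardTerm_le hK n x) x
  · rw [← differentiableOn_univ]
    intro z₀ _
    obtain ⟨K, hK⟩ := hK (‖z₀‖ + 1)
    obtain ⟨M, hM⟩ : ∃ M, ∀ z ∈ Metric.closedBall z₀ 1, ‖y₀ z‖ ≤ M :=
      (isCompact_closedBall z₀ 1).exists_bound_of_continuousOn hy.continuous.continuousOn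
    have hd := Complex.differentiableOn_tsum_of_summable_norm (U := Metric.ball z₀ 1)
      (F := fun n z => picardTerm A x₀ y₀ n z x)
      (u := fun n => M * ((K * |x - x₀|) ^ n / n.factorial)) ((hfac _).mul_left M)
      (fun n => (differentiable_picardTerm hA hAd hy n x).differentiableOn) Metric.isOpen_ball
      (fun n z hz => by
        have hz' : ‖z‖ ≤ ‖z₀‖ + 1 := by
          have := norm_sub_norm_le z z₀
          have := mem_ball_iff_norm.1 hz
          linarith
        have hK0 : 0 ≤ K := (norm_nonneg _).trans (hK z hz' 0)
        refine (norm_picardTerm_le (hK z hz') n x).trans ?_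
        exact mul_le_mul_of_nonneg_right (hM z (Metric.ball_subset_closedBall hz)) (by positivity))
    exact (hd.differentiableAt (Metric.ball_mem_nhds _ one_pos)).differentiableWithinAt

end Picard

/-- Backward Grönwall estimate for `‖y'‖ ≤ K ‖y‖`, together with the resulting bound for the
variation of `y`. -/
lemma norm_sub_le_of_norm_deriv_le_mul {E : Type*} [NormedAddCommGroup E] [NormedSpace ℝ E]
    {y y' : ℝ → E} {K L : ℝ} (hL : 0 ≤ L) (hK : 0 ≤ K)
    (hy : ∀ x ∈ Icc 0 L, HasDerivAt y (y' x) x)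
    (hb : ∀ x ∈ Icc 0 L, ‖y' x‖ ≤ K * ‖y x‖) :
    ‖y 0‖ ≤ Real.exp (K * L) * ‖y L‖ ∧ ‖y 0 - y L‖ ≤ K * L * Real.exp (K * L) * ‖y L‖ := by
  have hmem : ∀ {t}, t ∈ Icc 0 L → L - t ∈ Icc 0 L := fun {t} ht =>
    ⟨by linarith [ht.2], by linarith [ht.1]⟩
  have hd : ∀ t ∈ Icc 0 L, HasDerivAt (fun t => y (L - t)) (-y' (L - t)) t := fun t ht => by
    simpa [Function.comp_def] using (hy _ (hmem ht)).scomp t ((hasDerivAt_id t).const_sub L)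
  have hg : ∀ t ∈ Icc 0 L, ‖y (L - t)‖ ≤ ‖y L‖ * Real.exp (K * t) := fun t ht => by
    have := norm_le_gronwallBound_of_norm_deriv_right_le (f := fun t => y (L - t))
      (f' := fun t => -y' (L - t)) (δ := ‖y L‖) (K := K) (ε := 0) (a := 0) (b := L)
      (fun t ht => (hd t ht).continuousAt.continuousWithinAt)
      (fun t ht => (hd t (Ico_subset_Icc_self ht)).hasDerivWithinAt) (by simp)
      (fun t ht => by simpa using hb _ (hmem (Ico_subset_Icc_self ht))) t ht
    simpa [gronwallBound_ε0] using this
  constructor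
  · simpa [mul_comm] using hg L ⟨hL, le_rfl⟩
  · have := Convex.norm_image_sub_le_of_norm_hasDerivWithin_le (f := y) (f' := y')
      (s := Icc 0 L) (C := K * (‖y L‖ * Real.exp (K * L))) (x := L) (y := 0)
      (fun x hx => (hy x hx).hasDerivWithinAt) (fun x hx => (hb x hx).trans ?_) (convex_Icc _ _)
      ⟨hL, le_rfl⟩ ⟨le_rfl, hL⟩
    · calc _ ≤ _ := this
        _ = _ := by rw [zero_sub, norm_neg, Real.norm_of_nonneg hL]; ring
    · have h := hg (L - x) (hmem hx)
      rw [sub_sub_cancel] at h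
      refine mul_le_mul_of_nonneg_left (h.trans ?_) hK
      have := hx.1
      gcongr
      linarith

/-! ### Solutions of the Schrödinger equation -/

lemma SolvesSchrodinger.hasDerivAt {V : ℝ → ℝ} {lam : ℂ} {u : ℝ → ℂ}
    (h : SolvesSchrodinger V lam u) (x : ℝ) : HasDerivAt u (deriv u x) x :=
  (h.1.differentiable (by norm_num) x).hasDerivAt

lemma SolvesSchrodinger.hasDerivAt_deriv {V : ℝ → ℝ} {lam : ℂ} {u : ℝ → ℂ}
    (h : SolvesSchrodinger V lam u) (x : ℝ) :
    HasDerivAt (deriv u) (((V x : ℂ) - lam ^ 2) * u x) x := by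
  have hd : Differentiable ℝ (deriv u) := by
    have := h.1.differentiable_iteratedDeriv 1 (by norm_num)
    simpa [iteratedDeriv_one] using this
  have h2 := h.2 x
  rw [iteratedDeriv_succ, iteratedDeriv_one] at h2
  have e : ((V x : ℂ) - lam ^ 2) * u x = deriv (deriv u) x := by linear_combination h2
  rw [e]
  exact (hd x).hasDerivAt

lemma solvesSchrodinger_of_hasDerivAt {V : ℝ → ℝ} (hV : Continuous V) {lam : ℂ} {u p : ℝ → ℂ}
    (hu : ∀ x, HasDerivAt u (p x) x)
    (hp : ∀ x, HasDerivAt p (((V x : ℂ) - lam ^ 2) * u x) x) : SolvesSchrodinger V lam u := by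
  have e1 : deriv u = p := funext fun x => (hu x).deriv
  have e2 : deriv p = fun x => ((V x : ℂ) - lam ^ 2) * u x := funext fun x => (hp x).deriv
  have hc : Continuous u := continuous_iff_continuousAt.2 fun x => (hu x).continuousAt
  constructor
  · rw [show (2 : WithTop ℕ∞) = 1 + 1 by norm_num, contDiff_succ_iff_deriv]
    refine ⟨fun x => (hu x).differentiableAt, by simp, ?_⟩
    rw [e1, contDiff_one_iff_deriv]
    refine ⟨fun x => (hp x).differentiableAt, ?_⟩
    rw [e2]
    fun_prop
  · intro x
    rw [iteratedDeriv_succ, iteratedDeriv_one, e1, e2]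
    ring

/-- The coefficient matrix of the first order system for `(u, u')` that is equivalent to
`-u'' + q u = z² u`. -/
noncomputable def systemMatrix (q : ℝ) (z : ℂ) : ℂ × ℂ →L[ℂ] ℂ × ℂ :=
  (ContinuousLinearMap.inl ℂ ℂ ℂ).comp (ContinuousLinearMap.snd ℂ ℂ ℂ) +
    ((q : ℂ) - z ^ 2) • (ContinuousLinearMap.inr ℂ ℂ ℂ).comp (ContinuousLinearMap.fst ℂ ℂ ℂ)

lemma systemMatrix_apply (q : ℝ) (z : ℂ) (y : ℂ × ℂ) :
    systemMatrix q z y = (y.2, ((q : ℂ) - z ^ 2) * y.1) := by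
  simp [systemMatrix]

lemma norm_systemMatrix_le {q B : ℝ} (hq : |q| ≤ B) (z : ℂ) :
    ‖systemMatrix q z‖ ≤ 1 + B + ‖z‖ ^ 2 := by
  have hB : 0 ≤ B := (abs_nonneg q).trans hq
  refine ContinuousLinearMap.opNorm_le_bound _ (by positivity) fun y => ?_
  rw [systemMatrix_apply, Prod.norm_def]
  have h : ‖(q : ℂ) - z ^ 2‖ ≤ B + ‖z‖ ^ 2 := by
    refine (norm_sub_le _ _).trans ?_
    rw [norm_pow, Complex.norm_real, Real.norm_eq_abs]
    linarith
  refine max_le ?_ ?_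
  · have := norm_snd_le y
    have := norm_nonneg y
    nlinarith [mul_nonneg hB this, mul_nonneg (sq_nonneg ‖z‖) this]
  · rw [norm_mul]
    have h1 := norm_fst_le y
    calc _ ≤ (B + ‖z‖ ^ 2) * ‖y‖ := by gcongr
      _ ≤ _ := by nlinarith [norm_nonneg y]

/-- Uniqueness in the Cauchy problem, on an open interval. -/
lemma eqOn_of_hasDerivAt_schrodinger {V : ℝ → ℝ} {B : ℝ} (hB : ∀ x, |V x| ≤ B) {lam : ℂ}
    {u p v q : ℝ → ℂ} {a b x₀ : ℝ} (hx₀ : x₀ ∈ Ioo a b)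
    (hu : ∀ x ∈ Ioo a b, HasDerivAt u (p x) x)
    (hp : ∀ x ∈ Ioo a b, HasDerivAt p (((V x : ℂ) - lam ^ 2) * u x) x)
    (hv : ∀ x ∈ Ioo a b, HasDerivAt v (q x) x)
    (hq : ∀ x ∈ Ioo a b, HasDerivAt q (((V x : ℂ) - lam ^ 2) * v x) x)
    (h0 : u x₀ = v x₀) (h1 : p x₀ = q x₀) : EqOn u v (Ioo a b) := by
  have := ODE_solution_unique_of_mem_Ioo (v := fun x y => systemMatrix (V x) lam y)
    (s := fun _ => univ) (K := Real.toNNReal (1 + B + ‖lam‖ ^ 2))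
    (f := fun x => (u x, p x)) (g := fun x => (v x, q x)) (a := a) (b := b) (t₀ := x₀)
    (fun t _ => ((systemMatrix (V t) lam).lipschitz.weaken (by
      rw [← norm_toNNReal]
      exact Real.toNNReal_le_toNNReal (norm_systemMatrix_le (hB t) lam))).lipschitzOnWith) hx₀
    (fun t ht => ⟨by
      simpa only [systemMatrix_apply] using (hu t ht).prodMk (hp t ht), mem_univ _⟩)
    (fun t ht => ⟨by
      simpa only [systemMatrix_apply] using (hv t ht).prodMk (hq t ht), mem_univ _⟩)
    (by simp [h0, h1])
  intro x hx
  exact (Prod.ext_iff.1 (this hx)).1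

lemma SolvesSchrodinger.eq_of_eq {V : ℝ → ℝ} {B : ℝ} (hB : ∀ x, |V x| ≤ B) {lam : ℂ}
    {u v : ℝ → ℂ} (hu : SolvesSchrodinger V lam u) (hv : SolvesSchrodinger V lam v) {x₀ : ℝ}
    (h0 : u x₀ = v x₀) (h1 : deriv u x₀ = deriv v x₀) : u = v := by
  ext x
  exact eqOn_of_hasDerivAt_schrodinger (a := min x x₀ - 1) (b := max x x₀ + 1) hB (x₀ := x₀)
    ⟨by linarith [min_le_right x x₀], by linarith [le_max_right x x₀]⟩ (fun x _ => hu.hasDerivAt x)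
    (fun x _ => hu.hasDerivAt_deriv x) (fun x _ => hv.hasDerivAt x)
    (fun x _ => hv.hasDerivAt_deriv x) h0 h1
    ⟨by linarith [min_le_left x x₀], by linarith [le_max_left x x₀]⟩

/-- Solutions with entire Cauchy data at a point are entire in the spectral parameter, and so are
their derivatives. -/
lemma exists_solvesSchrodinger {V : ℝ → ℝ} (hV : Continuous V) {B : ℝ} (hB : ∀ x, |V x| ≤ B)
    (x₀ : ℝ) {α β : ℂ → ℂ} (hα : Differentiable ℂ α) (hβ : Differentiable ℂ β) :
    ∃ u : ℂ → ℝ → ℂ, (∀ z, SolvesSchrodinger V z (u z)) ∧ (∀ z, u z x₀ = α z) ∧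
      (∀ z, deriv (u z) x₀ = β z) ∧ (∀ x, Differentiable ℂ fun z => u z x) ∧
      ∀ x, Differentiable ℂ fun z => deriv (u z) x := by
  obtain ⟨y, hy0, hyd, hyh⟩ := exists_hasDerivAt_linear_of_bounded
    (A := fun z x => systemMatrix (V x) z) (x₀ := x₀) (y₀ := fun z => (α z, β z))
    (by unfold systemMatrix Function.uncurry; fun_prop)
    (fun t => by unfold systemMatrix; fun_prop)
    (hα.prodMk hβ)
    (fun r => ⟨1 + B + r ^ 2, fun z hz t => (norm_systemMatrix_le (hB t) z).trans (by gcongr)⟩)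
  have h1 : ∀ z x, HasDerivAt (fun x => (y z x).1) (y z x).2 x := fun z x => by
    have := (ContinuousLinearMap.fst ℝ ℂ ℂ).hasFDerivAt.comp_hasDerivAt x (hyd z x)
    rw [systemMatrix_apply] at this
    exact this
  have h2 : ∀ z x, HasDerivAt (fun x => (y z x).2) (((V x : ℂ) - z ^ 2) * (y z x).1) x :=
    fun z x => by
    have := (ContinuousLinearMap.snd ℝ ℂ ℂ).hasFDerivAt.comp_hasDerivAt x (hyd z x)
    rw [systemMatrix_apply] at this
    exact this
  refine ⟨fun z x => (y z x).1, fun z => solvesSchrodinger_of_hasDerivAt hV (h1 z) (h2 z),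
    fun z => by simp [hy0], fun z => by rw [(h1 z x₀).deriv, hy0],
    fun x => (hyh x).fst, fun x => ?_⟩
  simp_rw [fun z => (h1 z x).deriv]
  exact (hyh x).snd

/-! ### Growth of the reciprocal Gamma function -/

lemma norm_one_add_le_exp {p : ℝ} (hp1 : 1 ≤ p) (hp2 : p ≤ 2) (t : ℂ) :
    ‖1 + t‖ ≤ Real.exp (t.re + 2 * ‖t‖ ^ p) := by
  rcases le_total ‖t‖ 1 with h | h
  · have h1 : ‖1 + t‖ ^ 2 ≤ Real.exp (t.re + 2 * ‖t‖ ^ p) ^ 2 := by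
      have e : ‖1 + t‖ ^ 2 = 1 + (2 * t.re + ‖t‖ ^ 2) := by
        rw [Complex.sq_norm, Complex.sq_norm, Complex.normSq_apply, Complex.normSq_apply]
        simp only [Complex.add_re, Complex.one_re, Complex.add_im, Complex.one_im]
        ring
      have hle : ‖t‖ ^ 2 ≤ ‖t‖ ^ p := by
        rw [← Real.rpow_two]
        rcases (norm_nonneg t).eq_or_lt with h0 | h0
        · rw [← h0, Real.zero_rpow (by norm_num), Real.zero_rpow (by linarith)]
        · exact Real.rpow_le_rpow_of_exponent_ge h0 h hp2
      have h0 : 0 ≤ ‖t‖ ^ 2 := sq_nonneg _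
      rw [e, ← Real.exp_nat_mul, add_comm]
      refine (Real.add_one_le_exp _).trans (Real.exp_le_exp.2 ?_)
      push_cast
      linarith
    exact le_of_sq_le_sq h1 (Real.exp_pos _).le
  · have hle : ‖t‖ ≤ ‖t‖ ^ p := by
      simpa using Real.rpow_le_rpow_of_exponent_le h hp1
    have hre : -‖t‖ ≤ t.re := (abs_le.1 (Complex.abs_re_le_norm t)).1
    calc ‖1 + t‖ ≤ ‖t‖ + 1 := by
          simpa [add_comm] using norm_add_le 1 t
      _ ≤ Real.exp ‖t‖ := Real.add_one_le_exp _
      _ ≤ _ := Real.exp_le_exp.2 (by linarith)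

lemma norm_inv_GammaSeq_le {p : ℝ} (hp1 : 1 < p) (hp2 : p ≤ 2) (z : ℂ) {n : ℕ} (hn : n ≠ 0) :
    ‖(Complex.GammaSeq z n)⁻¹‖ ≤
      ‖z‖ * Real.exp (‖z‖ + 2 * ‖z‖ ^ p * ∑' k : ℕ, ((k + 1 : ℕ) : ℝ) ^ (-p)) := by
  have hn' : (0 : ℝ) < n := by positivity
  have hsum : Summable fun k : ℕ => ((k + 1 : ℕ) : ℝ) ^ (-p) :=
    (summable_nat_add_iff 1).2 (Real.summable_nat_rpow.2 (by linarith))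
  have hprod : ∏ j ∈ Finset.range (n + 1), (z + j) =
      z * (n.factorial * ∏ j ∈ Finset.range n, (1 + z / (j + 1 : ℕ))) := by
    rw [Finset.prod_range_succ', ← Finset.prod_range_add_one_eq_factorial]
    push_cast
    rw [← Finset.prod_mul_distrib, add_zero, mul_comm]
    congr 1
    refine Finset.prod_congr rfl fun j _ => ?_
    have : (j : ℂ) + 1 ≠ 0 := by exact_mod_cast Nat.succ_ne_zero j
    field_simp
    ring
  have hpw : ‖(n : ℂ) ^ z‖ = Real.exp (Real.log n * z.re) := by
    rw [← Complex.ofReal_natCast, Complex.norm_cpow_eq_rpow_re_of_pos hn',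
      Real.rpow_def_of_pos hn']
  have hE : ‖(Complex.GammaSeq z n)⁻¹‖ =
      ‖z‖ * (Real.exp (-(Real.log n * z.re)) *
        ∏ j ∈ Finset.range n, ‖1 + z / (j + 1 : ℕ)‖) := by
    rw [Complex.GammaSeq, hprod, inv_div, norm_div, norm_mul, norm_mul, norm_mul, hpw, norm_prod,
      Real.exp_neg]
    have : ‖(n.factorial : ℂ)‖ ≠ 0 := by simp [Nat.factorial_ne_zero]
    have := Real.exp_ne_zero (Real.log n * z.re)
    field_simp
  rw [hE]
  refine mul_le_mul_of_nonneg_left ?_ (norm_nonneg z)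
  have hfac : ∏ j ∈ Finset.range n, ‖1 + z / (j + 1 : ℕ)‖ ≤
      Real.exp (∑ j ∈ Finset.range n,
        (z.re * ((j + 1 : ℕ) : ℝ)⁻¹ + 2 * ‖z‖ ^ p * ((j + 1 : ℕ) : ℝ) ^ (-p))) := by
    rw [Real.exp_sum]
    refine Finset.prod_le_prod (fun _ _ => norm_nonneg _) fun j _ => ?_
    refine (norm_one_add_le_exp hp1.le hp2 _).trans (Real.exp_le_exp.2 (le_of_eq ?_))
    rw [norm_div, Complex.norm_natCast, Real.div_rpow (norm_nonneg _) (by positivity),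
      Real.rpow_neg (by positivity), Complex.div_natCast_re]
    ring
  have hH : ∑ j ∈ Finset.range n, ((j + 1 : ℕ) : ℝ)⁻¹ = ((harmonic n : ℚ) : ℝ) := by
    simp [harmonic]
  have hS : ∑ j ∈ Finset.range n, ((j + 1 : ℕ) : ℝ) ^ (-p) ≤
      ∑' k : ℕ, ((k + 1 : ℕ) : ℝ) ^ (-p) :=
    hsum.sum_le_tsum _ fun _ _ => by positivity
  -- The harmonic sum cancels `log n` up to an error in `[0, 1]`.
  have hlog1 : Real.log n ≤ harmonic n :=
    (Real.log_le_log hn' (by push_cast; linarith)).trans (log_add_one_le_harmonic n)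
  have hlog2 := harmonic_le_one_add_log n
  calc _ ≤ Real.exp (-(Real.log n * z.re)) * Real.exp (∑ j ∈ Finset.range n,
        (z.re * ((j + 1 : ℕ) : ℝ)⁻¹ + 2 * ‖z‖ ^ p * ((j + 1 : ℕ) : ℝ) ^ (-p))) := by gcongr
    _ ≤ _ := by
      rw [← Real.exp_add, Finset.sum_add_distrib, ← Finset.mul_sum, ← Finset.mul_sum, hH]
      refine Real.exp_le_exp.2 ?_
      have h1 : z.re * ((harmonic n : ℚ) - Real.log n) ≤ ‖z‖ := by
        have := Complex.abs_re_le_norm z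
        have := le_abs_self z.re
        have := norm_nonneg z
        nlinarith [mul_nonneg (sub_nonneg.2 (Complex.re_le_norm z)) (sub_nonneg.2 hlog1)]
      have h2 := mul_le_mul_of_nonneg_left hS (by positivity : 0 ≤ 2 * ‖z‖ ^ p)
      linarith

/-- The entire function `1 / Γ` has order at most one. The proof bounds the finite products
converging to it, each factor `1 + z / j` being compared with `exp (z / j)`. -/
theorem exists_norm_inv_Gamma_le {p : ℝ} (hp1 : 1 < p) (hp2 : p ≤ 2) :
    ∃ C : ℝ, 0 ≤ C ∧ ∀ z : ℂ, ‖(Complex.Gamma z)⁻¹‖ ≤ Real.exp (C * (1 + ‖z‖) ^ p) := by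
  set S := ∑' k : ℕ, ((k + 1 : ℕ) : ℝ) ^ (-p)
  have hS : 0 ≤ S := tsum_nonneg fun k => by positivity
  refine ⟨2 + 2 * S, by positivity, fun z => ?_⟩
  have h1 : ‖z‖ ≤ (1 + ‖z‖) ^ p := by
    have : 1 + ‖z‖ ≤ (1 + ‖z‖) ^ p := by
      simpa using Real.rpow_le_rpow_of_exponent_le (le_add_of_nonneg_right (norm_nonneg z)) hp1.le
    linarith
  have h2 : ‖z‖ ^ p ≤ (1 + ‖z‖) ^ p := by
    gcongr
    linarith
  rcases eq_or_ne (Complex.Gamma z) 0 with h0 | h0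
  · simp [h0, Real.exp_nonneg]
  refine le_of_tendsto ((Complex.GammaSeq_tendsto_Gamma z).inv₀ h0).norm ?_
  filter_upwards [eventually_ne_atTop 0] with n hn
  refine (norm_inv_GammaSeq_le hp1 hp2 z hn).trans ?_
  calc _ ≤ Real.exp ‖z‖ * Real.exp (‖z‖ + 2 * ‖z‖ ^ p * S) := by
        gcongr
        linarith [Real.add_one_le_exp ‖z‖]
    _ ≤ _ := by
      rw [← Real.exp_add]
      refine Real.exp_le_exp.2 ?_
      nlinarith

/-! ### Coefficients of the outgoing power series -/

/-- Polynomials `bₙ` in `mu` such that `aₙ = bₙ(mu) / Γ (n + 1 - mu)` solves the recursion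
`A² n (n - mu) aₙ = ∑_{m < n} f_{n-m} a_m`. -/
noncomputable def outgoingNumerator (f : ℕ → ℂ) (A : ℝ) (mu : ℂ) : ℕ → ℂ
  | 0 => 1
  | n + 1 => ((A : ℂ) ^ 2 * (n + 1 : ℕ))⁻¹ * ∑ m : Fin (n + 1),
      f (n + 1 - m) * (outgoingNumerator f A mu m * ∏ j ∈ Finset.Ico (m + 1 : ℕ) (n + 1), (j - mu))

/-- Coefficients of the outgoing power series, normalized to be entire in `mu`. -/
noncomputable def outgoingCoeff (f : ℕ → ℂ) (A : ℝ) (mu : ℂ) (n : ℕ) : ℂ :=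
  outgoingNumerator f A mu n * (Complex.Gamma (n + 1 - mu))⁻¹

lemma outgoingCoeff_zero (f : ℕ → ℂ) (A : ℝ) (mu : ℂ) :
    outgoingCoeff f A mu 0 = (Complex.Gamma (1 - mu))⁻¹ := by
  simp [outgoingCoeff, outgoingNumerator]

lemma differentiable_outgoingNumerator (f : ℕ → ℂ) (A : ℝ) (n : ℕ) :
    Differentiable ℂ fun mu => outgoingNumerator f A mu n := by
  induction n using Nat.strong_induction_on with
  | _ n ih =>
    cases n with
    | zero => simp [outgoingNumerator]
    | succ n =>
      simp_rw [outgoingNumerator]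
      refine (Differentiable.fun_sum fun m _ => ?_).const_mul _
      refine ((ih m m.2).mul ?_).const_mul _
      exact Differentiable.fun_finsetProd fun j _ => by fun_prop

lemma differentiable_outgoingCoeff (f : ℕ → ℂ) (A : ℝ) (n : ℕ) :
    Differentiable ℂ fun mu => outgoingCoeff f A mu n :=
  (differentiable_outgoingNumerator f A n).mul
    (Complex.differentiable_one_div_Gamma.comp (by fun_prop : Differentiable ℂ fun mu : ℂ =>
      (n : ℂ) + 1 - mu))

lemma inv_Gamma_eq_prod_mul {m n : ℕ} (h : m ≤ n) (mu : ℂ) :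
    (Complex.Gamma (m + 1 - mu))⁻¹ =
      (∏ j ∈ Finset.Ico (m + 1) (n + 1), ((j : ℂ) - mu)) * (Complex.Gamma (n + 1 - mu))⁻¹ := by
  induction n, h using Nat.le_induction with
  | base => simp
  | succ n hn ih =>
    rw [ih, Finset.prod_Ico_succ_top (show m + 1 ≤ n + 1 by omega),
      Complex.one_div_Gamma_eq_self_mul_one_div_Gamma_add_one ((n : ℂ) + 1 - mu),
      show ((n + 1 : ℕ) : ℂ) + 1 - mu = (n : ℂ) + 1 - mu + 1 by push_cast; ring]
    push_cast
    ring

lemma outgoingCoeff_recursion (f : ℕ → ℂ) {A : ℝ} (hA : A ≠ 0) (mu : ℂ) {n : ℕ} (hn : n ≠ 0) :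
    (A : ℂ) ^ 2 * n * (n - mu) * outgoingCoeff f A mu n =
      ∑ m ∈ Finset.range n, f (n - m) * outgoingCoeff f A mu m := by
  obtain ⟨n, rfl⟩ := Nat.exists_eq_succ_of_ne_zero hn
  have hA' : (A : ℂ) ≠ 0 := by exact_mod_cast hA
  have hn' : ((n + 1 : ℕ) : ℂ) ≠ 0 := by exact_mod_cast Nat.succ_ne_zero n
  have hG := Complex.one_div_Gamma_eq_self_mul_one_div_Gamma_add_one ((n : ℂ) + 1 - mu)
  have key : ∀ m ∈ Finset.range (n + 1), f (n + 1 - m) * outgoingCoeff f A mu m =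
      f (n + 1 - m) * (outgoingNumerator f A mu m *
        ∏ j ∈ Finset.Ico (m + 1 : ℕ) (n + 1), ((j : ℂ) - mu)) *
        (Complex.Gamma (n + 1 - mu))⁻¹ := fun m hm => by
    rw [outgoingCoeff, inv_Gamma_eq_prod_mul (Nat.lt_succ_iff.1 (Finset.mem_range.1 hm))]
    ring
  rw [Nat.succ_eq_add_one, Finset.sum_congr rfl key, ← Finset.sum_mul, hG, outgoingCoeff,
    outgoingNumerator, Finset.sum_range fun m => f (n + 1 - m) * (outgoingNumerator f A mu m *
        ∏ j ∈ Finset.Ico (m + 1 : ℕ) (n + 1), ((j : ℂ) - mu))]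
  have e : ((n + 1 : ℕ) : ℂ) + 1 - mu = (n : ℂ) + 1 - mu + 1 := by push_cast; ring
  rw [e]
  push_cast at hn' ⊢
  field_simp

/-- Geometric bound for solutions of the recursion when `mu` keeps the distance `κ` from the
positive integers. -/
lemma norm_le_of_recursion {f a : ℕ → ℂ} {A κ M r s : ℝ} {mu : ℂ} (hA : A ≠ 0)
    (hM : 0 ≤ M) (hr : 0 < r) (hf : ∀ k, ‖f k‖ ≤ M * r ^ k)
    (hs : s = 2 * r + 4 * M * r / A ^ 2)
    (hrec : ∀ n : ℕ, n ≠ 0 → (A : ℂ) ^ 2 * n * (n - mu) * a n =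
      ∑ m ∈ Finset.range n, f (n - m) * a m)
    (hκ : 1 / 2 ≤ κ) (hmu : ∀ j : ℕ, j ≠ 0 → κ ≤ ‖(j : ℂ) - mu‖) (n : ℕ) :
    ‖a n‖ ≤ s ^ n * ‖a 0‖ ∧ (n ≠ 0 → κ * ‖a n‖ ≤ s ^ n * ‖a 0‖ / 2) := by
  have hA2 : 0 < A ^ 2 := by positivity
  have hsr : 2 * r ≤ s := by
    have : 0 ≤ 4 * M * r / A ^ 2 := by positivity
    linarith
  have hs0 : 0 < s := by linarith
  have hsM : 4 * M * r ≤ A ^ 2 * s := by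
    rw [hs, mul_add, mul_div_cancel₀ _ hA2.ne']
    have : 0 < A ^ 2 * (2 * r) := by positivity
    linarith
  have hgeom : ∀ n : ℕ, s * ∑ m ∈ Finset.range n, r ^ (n - m) * s ^ m ≤ 2 * r * s ^ n := by
    intro n
    induction n with
    | zero => simpa using hr.le
    | succ n ih =>
      have : ∑ m ∈ Finset.range (n + 1), r ^ (n + 1 - m) * s ^ m =
          r * (∑ m ∈ Finset.range n, r ^ (n - m) * s ^ m) + r * s ^ n := by
        rw [Finset.sum_range_succ, Finset.mul_sum]
        congr 1
        · refine Finset.sum_congr rfl fun m hm => ?_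
          rw [Nat.succ_sub (Finset.mem_range.1 hm).le, pow_succ]
          ring
        · simp
      rw [this, pow_succ]
      have h1 := mul_le_mul_of_nonneg_left ih hr.le
      have h2 : r * s ^ n * (2 * r) ≤ r * s ^ n * s :=
        mul_le_mul_of_nonneg_left hsr (by positivity)
      nlinarith
  have main : ∀ n : ℕ, n ≠ 0 → (∀ m < n, ‖a m‖ ≤ s ^ m * ‖a 0‖) →
      κ * ‖a n‖ ≤ s ^ n * ‖a 0‖ / 2 := by
    intro n hn ih
    have h1 : A ^ 2 * n * ‖(n : ℂ) - mu‖ * ‖a n‖ ≤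
        M * ‖a 0‖ * ∑ m ∈ Finset.range n, r ^ (n - m) * s ^ m := by
      have := congrArg norm (hrec n hn)
      simp only [norm_mul, norm_pow, Complex.norm_real, Complex.norm_natCast, Real.norm_eq_abs,
        sq_abs] at this
      rw [this, Finset.mul_sum]
      refine (norm_sum_le _ _).trans (Finset.sum_le_sum fun m hm => ?_)
      rw [norm_mul]
      calc _ ≤ (M * r ^ (n - m)) * (s ^ m * ‖a 0‖) :=
            mul_le_mul (hf _) (ih m (Finset.mem_range.1 hm)) (norm_nonneg _) (by positivity)
        _ = _ := by ring
    have h2 : A ^ 2 * (κ * ‖a n‖) ≤ A ^ 2 * n * ‖(n : ℂ) - mu‖ * ‖a n‖ := by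
      have hn1 : (1 : ℝ) ≤ n := by exact_mod_cast Nat.one_le_iff_ne_zero.2 hn
      have := mul_le_mul hn1 (hmu n hn) (by linarith) (by linarith)
      calc _ = A ^ 2 * ‖a n‖ * (1 * κ) := by ring
        _ ≤ A ^ 2 * ‖a n‖ * (n * ‖(n : ℂ) - mu‖) := by gcongr
        _ = _ := by ring
    have h3 := (h2.trans h1)
    have h4 : A ^ 2 * s * (κ * ‖a n‖) ≤ A ^ 2 * s * (s ^ n * ‖a 0‖ / 2) := by
      have h5 := mul_le_mul_of_nonneg_left (hgeom n) (by positivity : 0 ≤ M * ‖a 0‖)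
      have h6 := mul_le_mul_of_nonneg_left h3 hs0.le
      have h7 := mul_le_mul_of_nonneg_right hsM (by positivity : 0 ≤ s ^ n * ‖a 0‖ / 2)
      linarith
    exact le_of_mul_le_mul_left h4 (by positivity)
  have hall : ∀ n, ‖a n‖ ≤ s ^ n * ‖a 0‖ := by
    intro n
    induction n using Nat.strong_induction_on with
    | _ n ih =>
      rcases eq_or_ne n 0 with rfl | hn
      · simp
      · have := main n hn ih
        nlinarith [norm_nonneg (a n)]
  exact ⟨hall n, fun hn => main n hn fun m _ => hall m⟩

/-- The estimate away from the positive integers extends to all `mu` by the maximum principle on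
the discs `‖mu‖ ≤ N + 1 / 2`. -/
lemma exists_norm_outgoingCoeff_le {f : ℕ → ℂ} {A M r s : ℝ} (hA : A ≠ 0)
    (hM : 0 ≤ M) (hr : 0 < r) (hf : ∀ k, ‖f k‖ ≤ M * r ^ k)
    (hs : s = 2 * r + 4 * M * r / A ^ 2) {p : ℝ} (hp1 : 1 < p) (hp2 : p ≤ 2) :
    ∃ C : ℝ, 0 ≤ C ∧ ∀ mu n,
      ‖outgoingCoeff f A mu n‖ ≤ Real.exp (C * (1 + ‖mu‖) ^ p) * s ^ n := by
  obtain ⟨C, hC, hG⟩ := exists_norm_inv_Gamma_le hp1 hp2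
  refine ⟨C * 4 ^ p, by positivity, fun mu n => ?_⟩
  obtain ⟨N, hN⟩ : ∃ N, N = ⌈‖mu‖⌉₊ := ⟨_, rfl⟩
  have hN1 : ‖mu‖ ≤ N := by rw [hN]; exact Nat.le_ceil _
  have hN2 : (N : ℝ) ≤ ‖mu‖ + 1 := by rw [hN]; exact (Nat.ceil_lt_add_one (norm_nonneg _)).le
  have hR : (N : ℝ) + 1 / 2 ≠ 0 := by positivity
  have hs0 : 0 ≤ s := by rw [hs]; positivity
  refine Complex.norm_le_of_forall_mem_frontier_norm_le
    (f := fun mu => outgoingCoeff f A mu n) (U := Metric.ball 0 (N + 1 / 2)) Metric.isBounded_ball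
    (differentiable_outgoingCoeff f A n).diffContOnCl (fun z hz => ?_)
    (subset_closure (by simpa using by linarith))
  rw [frontier_ball _ hR, mem_sphere_zero_iff_norm] at hz
  refine ((norm_le_of_recursion hA hM hr hf hs
    (fun n hn => outgoingCoeff_recursion f hA z hn) le_rfl (fun j _ => ?_) n).1).trans ?_
  · -- `‖z‖` is a half-integer, hence at distance at least `1 / 2` from every integer.
    have h1 := norm_sub_norm_le (j : ℂ) z
    have h2 := norm_sub_norm_le z (j : ℂ)
    rw [norm_sub_rev z] at h2
    rw [hz, Complex.norm_natCast] at h1 h2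
    rcases le_or_gt j N with h | h
    · have : (j : ℝ) ≤ N := by exact_mod_cast h
      linarith
    · have : (N : ℝ) + 1 ≤ j := by exact_mod_cast h
      linarith
  · rw [mul_comm, outgoingCoeff_zero]
    gcongr
    refine (hG _).trans (Real.exp_le_exp.2 ?_)
    rw [mul_assoc, ← Real.mul_rpow (by norm_num) (by positivity)]
    gcongr
    have := norm_sub_le 1 z
    rw [norm_one, hz] at this
    linarith [norm_nonneg mu]

/-! ### Series in exponentials -/

lemma norm_mul_pow_le {a : ℕ → ℂ} {D s ρ : ℝ} (ha : ∀ n, ‖a n‖ ≤ D * s ^ n) {w : ℂ}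
    (hs : 0 ≤ s) (hw : ‖w‖ ≤ ρ) (n : ℕ) : ‖a n * w ^ n‖ ≤ D * (s * ρ) ^ n := by
  have hD : 0 ≤ D := by simpa using (norm_nonneg _).trans (ha 0)
  rw [norm_mul, norm_pow, mul_pow, ← mul_assoc]
  gcongr
  exact ha n

lemma summable_mul_pow {a : ℕ → ℂ} {D s : ℝ} (ha : ∀ n, ‖a n‖ ≤ D * s ^ n) {w : ℂ}
    (hs : 0 ≤ s) (hw : s * ‖w‖ < 1) : Summable fun n => ‖a n * w ^ n‖ :=
  Summable.of_nonneg_of_le (fun _ => norm_nonneg _) (norm_mul_pow_le ha hs le_rfl)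
    ((summable_geometric_of_lt_one (by positivity) hw).mul_left D)

lemma norm_tsum_mul_pow_le {a : ℕ → ℂ} {D s : ℝ} (ha : ∀ n, ‖a n‖ ≤ D * s ^ n) {w : ℂ}
    (hs : 0 ≤ s) (hw : s * ‖w‖ ≤ 1 / 2) : ‖∑' n, a n * w ^ n‖ ≤ 2 * D := by
  have hD : 0 ≤ D := by simpa using (norm_nonneg _).trans (ha 0)
  have h := tsum_of_norm_bounded
    ((hasSum_geometric_of_lt_one (by positivity) (by linarith : s * ‖w‖ < 1)).mul_left D)
    (norm_mul_pow_le ha hs le_rfl)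
  refine h.trans ?_
  rw [mul_comm]
  gcongr
  rw [inv_le_comm₀ (by linarith) (by norm_num)]
  linarith

lemma analyticAt_tsum_mul_pow {a : ℕ → ℂ} {D s : ℝ} (ha : ∀ n, ‖a n‖ ≤ D * s ^ n) {w : ℂ}
    (hs : 0 ≤ s) (hw : s * ‖w‖ < 1) :
    AnalyticAt ℂ (fun w => ∑' n, a n * w ^ n) w ∧
      w * deriv (fun w => ∑' n, a n * w ^ n) w = ∑' n, (n * a n) * w ^ n := by
  obtain ⟨ρ, hρ1, hρ2⟩ : ∃ ρ, ‖w‖ < ρ ∧ s * ρ < 1 := by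
    have hc : ContinuousAt (fun ρ => s * ρ) ‖w‖ := by fun_prop
    have h1 : ∀ᶠ ρ in 𝓝[>] ‖w‖, s * ρ < 1 :=
      (hc.eventually_lt continuousAt_const hw).filter_mono nhdsWithin_le_nhds
    exact (eventually_mem_nhdsWithin.and h1).exists
  have hρ0 : 0 ≤ ρ := (norm_nonneg _).trans hρ1.le
  have hu : Summable fun n : ℕ => D * (s * ρ) ^ n :=
    (summable_geometric_of_lt_one (by positivity) hρ2).mul_left D
  have hd : ∀ n : ℕ, DifferentiableOn ℂ (fun w => a n * w ^ n) (Metric.ball 0 ρ) :=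
    fun n => by fun_prop
  have hb : ∀ (n : ℕ) (z : ℂ), z ∈ Metric.ball 0 ρ → ‖a n * z ^ n‖ ≤ D * (s * ρ) ^ n :=
    fun n z hz => norm_mul_pow_le ha hs (mem_ball_zero_iff.1 hz).le n
  have hmem : w ∈ Metric.ball (0 : ℂ) ρ := mem_ball_zero_iff.2 hρ1
  refine ⟨(Complex.differentiableOn_tsum_of_summable_norm hu hd Metric.isOpen_ball hb).analyticAt
    (Metric.isOpen_ball.mem_nhds hmem), ?_⟩
  have := (Complex.hasSum_deriv_of_summable_norm hu hd Metric.isOpen_ball hb hmem).mul_left w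
  rw [← this.tsum_eq]
  refine tsum_congr fun n => ?_
  rw [deriv_const_mul _ (by fun_prop), deriv_pow_field]
  rcases n with _ | n
  · simp
  · simp only [Nat.add_sub_cancel, pow_succ]
    ring

/-- The function `exp (i lam x) ∑ aₙ exp (-n A x)`. -/
noncomputable def expSeries (A : ℝ) (lam : ℂ) (a : ℕ → ℂ) (x : ℝ) : ℂ :=
  Complex.exp (Complex.I * lam * x) * ∑' n, a n * Complex.exp (-(A * x)) ^ n

lemma norm_exp_neg_mul_ofReal (A x : ℝ) : ‖Complex.exp (-(A * x))‖ = Real.exp (-(A * x)) := by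
  rw [Complex.norm_exp]
  simp

lemma hasDerivAt_expSeries {A : ℝ} {lam : ℂ} {a : ℕ → ℂ} {D s : ℝ}
    (ha : ∀ n, ‖a n‖ ≤ D * s ^ n) (hs : 0 ≤ s) {x : ℝ} (hx : s * Real.exp (-(A * x)) < 1) :
    HasDerivAt (expSeries A lam a)
      (expSeries A lam (fun n => (Complex.I * lam - n * A) * a n) x) x := by
  set w := Complex.exp (-(A * x)) with hw
  have hws : s * ‖w‖ < 1 := by rwa [hw, norm_exp_neg_mul_ofReal]
  obtain ⟨h1, h2⟩ := analyticAt_tsum_mul_pow ha hs hws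
  have e1 : HasDerivAt (fun z : ℂ => Complex.exp (-(A * z))) (w * -A) x := by
    have : HasDerivAt (fun z : ℂ => -(A * z)) (-A) x := by
      simpa using ((hasDerivAt_id (x : ℂ)).const_mul (A : ℂ)).fun_neg
    exact this.cexp
  have e2 : HasDerivAt (fun z : ℂ => Complex.exp (Complex.I * lam * z))
      (Complex.exp (Complex.I * lam * x) * (Complex.I * lam)) x := by
    have : HasDerivAt (fun z : ℂ => Complex.I * lam * z) (Complex.I * lam) x := by
      simpa using (hasDerivAt_id (x : ℂ)).const_mul (Complex.I * lam)
    exact this.cexp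
  have e3 := (e2.mul (h1.differentiableAt.hasDerivAt.comp (x : ℂ) e1)).comp_ofReal
  have hsum : Summable fun n => a n * w ^ n := (summable_mul_pow ha hs hws).of_norm
  have hsum' : Summable fun n : ℕ => (n * a n) * w ^ n := by
    have hs1 : Summable fun n : ℕ => D * ((n : ℝ) ^ 1 * (s * ‖w‖) ^ n) :=
      (summable_pow_mul_geometric_of_norm_lt_one 1
        (by rwa [Real.norm_of_nonneg (by positivity)])).mul_left D
    refine Summable.of_norm_bounded hs1 fun n => ?_
    rw [mul_assoc, norm_mul, Complex.norm_natCast, pow_one, ← mul_assoc, mul_comm D, mul_assoc]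
    exact mul_le_mul_of_nonneg_left (norm_mul_pow_le ha hs le_rfl n) (Nat.cast_nonneg n)
  have e4 : ∑' n : ℕ, ((Complex.I * lam - n * A) * a n) * w ^ n =
      Complex.I * lam * (∑' n, a n * w ^ n) - A * ∑' n : ℕ, (n * a n) * w ^ n := by
    rw [← tsum_mul_left, ← tsum_mul_left, ← (hsum.mul_left _).tsum_sub (hsum'.mul_left _)]
    exact tsum_congr fun n => by ring
  unfold expSeries
  rw [← hw, e4, ← h2]
  refine e3.congr_deriv ?_
  simp only [Function.comp_apply, ← hw]
  ring

lemma norm_linear_mul_le {a : ℕ → ℂ} {A D s : ℝ} (hA : 0 ≤ A) (c : ℂ)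
    (ha : ∀ n, ‖a n‖ ≤ D * s ^ n) (n : ℕ) :
    ‖(c - n * A) * a n‖ ≤ ((‖c‖ + A) * D) * (2 * s) ^ n := by
  have h2 : (n : ℝ) ≤ 2 ^ n := by exact_mod_cast Nat.lt_two_pow_self.le
  have h1 : (1 : ℝ) ≤ 2 ^ n := one_le_pow₀ (by norm_num)
  have h3 : ‖c - n * A‖ ≤ (‖c‖ + A) * 2 ^ n := by
    refine (norm_sub_le _ _).trans ?_
    rw [norm_mul, Complex.norm_natCast, Complex.norm_real, Real.norm_of_nonneg hA]
    nlinarith [norm_nonneg c]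
  rw [norm_mul, mul_pow]
  calc _ ≤ ((‖c‖ + A) * 2 ^ n) * (D * s ^ n) :=
        mul_le_mul h3 (ha n) (norm_nonneg _) (by positivity)
    _ = _ := by ring

/-! ### The outgoing family at `+∞` -/

/-- The assumptions on the potential that enter the analysis at `+∞`; reflection reduces `-∞` to
this case. -/
structure IsExpAnalyticAtTop (V : ℝ → ℝ) (A : ℝ) : Prop where
  pos : 0 < A
  continuous : Continuous V
  bounded : ∃ B, ∀ x, |V x| ≤ B
  expansion : ∃ R : ℝ, ∃ F : ℂ → ℂ, AnalyticAt ℂ F 0 ∧ F 0 = 0 ∧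
    ∀ x : ℝ, R < x → (V x : ℂ) = F (Complex.exp (-(A * x)))

lemma exists_coeff_of_analyticAt_zero {F : ℂ → ℂ} (hF : AnalyticAt ℂ F 0) (h0 : F 0 = 0) :
    ∃ (f : ℕ → ℂ) (M r ρ : ℝ), f 0 = 0 ∧ 0 < M ∧ 0 < r ∧ 0 < ρ ∧ (∀ k, ‖f k‖ ≤ M * r ^ k) ∧
      ∀ w : ℂ, ‖w‖ < ρ → HasSum (fun k => f k * w ^ k) (F w) := by
  obtain ⟨P, hP⟩ := hF
  obtain ⟨R, hR⟩ := hP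
  obtain ⟨M, r, hM, hr, hb⟩ := P.le_mul_pow_of_radius_pos (hR.r_pos.trans_le hR.r_le)
  obtain ⟨ρ, hρ0, hρ⟩ := ENNReal.lt_iff_exists_nnreal_btwn.1 hR.r_pos
  refine ⟨P.coeff, M, r, ρ, ?_, hM, hr, by exact_mod_cast hρ0, fun k => ?_, fun w hw => ?_⟩
  · rw [← h0]
    exact hR.coeff_zero _
  · rw [← FormalMultilinearSeries.norm_apply_eq_norm_coef]
    exact hb k
  · have hmem : w ∈ Metric.eball (0 : ℂ) R := by
      refine lt_trans ?_ hρ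
      rw [edist_zero_right, enorm_lt_coe]
      exact_mod_cast hw
    have := hR.hasSum hmem
    simpa [FormalMultilinearSeries.apply_eq_pow_smul_coeff, mul_comm] using this

lemma differentiable_expSeries {A x : ℝ} {c : ℂ → ℕ → ℂ} {s : ℝ} (hs : 0 ≤ s)
    (hx : s * Real.exp (-(A * x)) < 1) (hc : ∀ n, Differentiable ℂ fun z => c z n)
    (hb : ∀ r : ℝ, ∃ D : ℝ, ∀ z : ℂ, ‖z‖ ≤ r → ∀ n, ‖c z n‖ ≤ D * s ^ n) :
    Differentiable ℂ fun z => expSeries A z (c z) x := by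
  unfold expSeries
  refine Differentiable.mul (by fun_prop) ?_
  intro z₀
  obtain ⟨D, hD⟩ := hb (‖z₀‖ + 1)
  have hn := norm_exp_neg_mul_ofReal A x
  refine (Complex.differentiableOn_tsum_of_summable_norm (U := Metric.ball z₀ 1)
    (F := fun n z => c z n * Complex.exp (-(A * x)) ^ n)
    ((summable_geometric_of_lt_one (by positivity) hx).mul_left D)
    (fun n => ((hc n).mul_const _).differentiableOn) Metric.isOpen_ball
    fun n z hz => norm_mul_pow_le (hD z ?_) hs hn.le n).differentiableAt
    (Metric.ball_mem_nhds _ one_pos)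
  have := norm_sub_norm_le z z₀
  have := mem_ball_iff_norm.1 hz
  linarith

/-- The recursion for the coefficients is the differential equation. -/
lemma expSeries_second_deriv_eq {f : ℕ → ℂ} {A x D M r s : ℝ} {lam q : ℂ} {a : ℕ → ℂ} (hA : A ≠ 0)
    (f0 : f 0 = 0) (hr : 0 ≤ r) (hf : ∀ k, ‖f k‖ ≤ M * r ^ k)
    (hrx : r * Real.exp (-(A * x)) < 1)
    (hq : HasSum (fun k => f k * Complex.exp (-(A * x)) ^ k) q) (hs : 0 ≤ s)
    (ha : ∀ n, ‖a n‖ ≤ D * s ^ n) (hx : s * Real.exp (-(A * x)) < 1)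
    (hrec : ∀ n : ℕ, n ≠ 0 → (A : ℂ) ^ 2 * n * (n - 2 * Complex.I * lam / A) * a n =
      ∑ m ∈ Finset.range n, f (n - m) * a m) :
    expSeries A lam (fun n => (Complex.I * lam - n * A) * ((Complex.I * lam - n * A) * a n)) x =
      (q - lam ^ 2) * expSeries A lam a x := by
  have hA' : (A : ℂ) ≠ 0 := by exact_mod_cast hA
  unfold expSeries
  have hnw := norm_exp_neg_mul_ofReal A x
  set w := Complex.exp (-(A * x))
  have hfs := summable_mul_pow hf hr (w := w) (by rwa [hnw])
  have has := summable_mul_pow ha hs (w := w) (by rwa [hnw])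
  have hconv : ∀ n, ∑ m ∈ Finset.range (n + 1), a m * w ^ m * (f (n - m) * w ^ (n - m)) =
      (Complex.I * lam - n * A) * ((Complex.I * lam - n * A) * a n) * w ^ n +
        lam ^ 2 * (a n * w ^ n) := by
    intro n
    have h1 : ∑ m ∈ Finset.range n, a m * w ^ m * (f (n - m) * w ^ (n - m)) =
        (∑ m ∈ Finset.range n, f (n - m) * a m) * w ^ n := by
      rw [Finset.sum_mul]
      refine Finset.sum_congr rfl fun m hm => ?_
      rw [← pow_sub_mul_pow w (Finset.mem_range.1 hm).le]
      ring
    rw [Finset.sum_range_succ, h1, Nat.sub_self, f0]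
    have h2 : ∑ m ∈ Finset.range n, f (n - m) * a m =
        (A : ℂ) ^ 2 * n * (n - 2 * Complex.I * lam / A) * a n := by
      rcases eq_or_ne n 0 with rfl | hn
      · simp
      · exact (hrec n hn).symm
    rw [h2]
    field_simp
    linear_combination (-lam ^ 2 * a n * w ^ n) * Complex.I_sq
  have hprod := tsum_mul_tsum_eq_tsum_sum_range_of_summable_norm has hfs
  have hcs : Summable fun n => (Complex.I * lam - n * A) * ((Complex.I * lam - n * A) * a n) *
      w ^ n + lam ^ 2 * (a n * w ^ n) := by
    refine (summable_norm_sum_mul_range_of_summable_norm has hfs).of_norm.congr fun n => ?_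
    exact hconv n
  have hd : ∑' n : ℕ, (Complex.I * lam - n * A) * ((Complex.I * lam - n * A) * a n) * w ^ n =
      (∑' n, ∑ m ∈ Finset.range (n + 1), a m * w ^ m * (f (n - m) * w ^ (n - m))) -
        lam ^ 2 * ∑' n, a n * w ^ n := by
    rw [← tsum_mul_left, tsum_congr hconv, ← hcs.tsum_sub (has.of_norm.mul_left _)]
    exact tsum_congr fun n => by ring
  rw [hd, ← hprod, hq.tsum_eq]
  ring

/-- Existence of the outgoing family: a convergent series for large `x`, continued to the line by
the Cauchy problem. The Cauchy data at a point `x₀` of the region of convergence are recorded. -/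
theorem IsExpAnalyticAtTop.exists_family {V : ℝ → ℝ} {A : ℝ} (h : IsExpAnalyticAtTop V A) :
    ∃ (u : ℂ → ℝ → ℂ) (f : ℕ → ℂ) (M r s x₀ : ℝ),
      IsOutgoingFamilyPlus V A u ∧ (∀ x, Differentiable ℂ fun z => deriv (u z) x) ∧
      0 ≤ M ∧ 0 < r ∧ (∀ k, ‖f k‖ ≤ M * r ^ k) ∧ s = 2 * r + 4 * M * r / A ^ 2 ∧
      0 < x₀ ∧ 2 * s * Real.exp (-(A * x₀)) ≤ 1 / 2 ∧
      (∀ z, u z x₀ = expSeries A z (outgoingCoeff f A (2 * Complex.I * z / A)) x₀) ∧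
      ∀ z, deriv (u z) x₀ = expSeries A z (fun n => (Complex.I * z - n * A) *
        outgoingCoeff f A (2 * Complex.I * z / A) n) x₀ := by
  obtain ⟨hA, hVc, ⟨B, hB⟩, R, F, hFa, hF0, hVF⟩ := h
  obtain ⟨f, M, r, ρ, f0, hM, hr, hρ, hf, hFs⟩ := exists_coeff_of_analyticAt_zero hFa hF0
  obtain ⟨s, hs⟩ : ∃ s, s = 2 * r + 4 * M * r / A ^ 2 := ⟨_, rfl⟩
  have hrs : r ≤ s := by
    have : 0 ≤ 4 * M * r / A ^ 2 := by positivity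
    linarith
  have hs0 : 0 < s := hr.trans_le hrs
  have hexp : Tendsto (fun x : ℝ => Real.exp (-(A * x))) atTop (𝓝 0) :=
    Real.tendsto_exp_neg_atTop_nhds_zero.comp (tendsto_id.const_mul_atTop hA)
  obtain ⟨x₁, hx₁⟩ : ∃ x₁ : ℝ, 0 < x₁ ∧ R < x₁ ∧ Real.exp (-(A * x₁)) < ρ ∧
      Real.exp (-(A * x₁)) < 1 / (4 * s) :=
    ((eventually_gt_atTop 0).and ((eventually_gt_atTop R).and
      ((hexp.eventually_lt_const hρ).and (hexp.eventually_lt_const (by positivity))))).exists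
  obtain ⟨hx0, hxR, hxρ, hxs⟩ := hx₁
  have hmono : ∀ x, x₁ < x → Real.exp (-(A * x)) < Real.exp (-(A * x₁)) := fun x hx =>
    Real.exp_lt_exp.2 (by nlinarith)
  have h4 : ∀ x, x₁ < x → 2 * s * Real.exp (-(A * x)) < 1 / 2 := fun x hx => by
    have := (hmono x hx).trans hxs
    rw [lt_div_iff₀ (by positivity)] at this
    linarith
  have h2s : ∀ x, x₁ < x → 2 * s * Real.exp (-(A * x)) < 1 := fun x hx => by linarith [h4 x hx]
  have h1s : ∀ x, x₁ < x → s * Real.exp (-(A * x)) < 1 := fun x hx => by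
    have := h4 x hx
    have := mul_pos hs0 (Real.exp_pos (-(A * x)))
    linarith
  obtain ⟨C, hC, hbd⟩ := exists_norm_outgoingCoeff_le hA.ne' hM.le hr hf hs one_lt_two le_rfl
  obtain ⟨a, ha_def⟩ : ∃ a : ℂ → ℕ → ℂ, a = fun z => outgoingCoeff f A (2 * Complex.I * z / A) :=
    ⟨_, rfl⟩
  have ha : ∀ z n, ‖a z n‖ ≤
      Real.exp (C * (1 + ‖2 * Complex.I * z / A‖) ^ (2 : ℝ)) * s ^ n := fun z n => by
    rw [ha_def]
    exact hbd _ n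
  have had : ∀ n, Differentiable ℂ fun z => a z n := fun n => by
    rw [ha_def]
    exact (differentiable_outgoingCoeff f A n).comp (by fun_prop)
  have hnorm : ∀ z : ℂ, ‖2 * Complex.I * z / A‖ = 2 * ‖z‖ / A := fun z => by
    rw [norm_div, norm_mul, norm_mul, Complex.norm_I, Complex.norm_real, Real.norm_of_nonneg hA.le]
    simp
  have hal : ∀ t : ℝ, ∃ D : ℝ, ∀ z : ℂ, ‖z‖ ≤ t → ∀ n, ‖a z n‖ ≤ D * s ^ n := fun t =>
    ⟨Real.exp (C * (1 + 2 * t / A) ^ (2 : ℝ)), fun z hz n => (ha z n).trans (by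
      rw [hnorm]
      gcongr)⟩
  have hx₂ : x₁ < x₁ + 1 := by linarith
  have hα : Differentiable ℂ fun z => expSeries A z (a z) (x₁ + 1) :=
    differentiable_expSeries hs0.le (h1s _ hx₂) had hal
  have hβ : Differentiable ℂ fun z =>
      expSeries A z (fun n => (Complex.I * z - n * A) * a z n) (x₁ + 1) := by
    refine differentiable_expSeries (c := fun z n => (Complex.I * z - n * A) * a z n)
      (by positivity : 0 ≤ 2 * s) (h2s _ hx₂) (fun n => ?_) fun t => ?_
    · have := had n
      fun_prop
    · obtain ⟨D, hD⟩ := hal t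
      refine ⟨(t + A) * D, fun z hz n => ?_⟩
      have hD0 : 0 ≤ D := by simpa using (norm_nonneg _).trans (hD z hz 0)
      refine (norm_linear_mul_le hA.le (Complex.I * z) (hD z hz) n).trans ?_
      rw [norm_mul, Complex.norm_I, one_mul]
      gcongr
  obtain ⟨u, hu, hu0, hu1, hue, hue'⟩ := exists_solvesSchrodinger hVc hB (x₁ + 1) hα hβ
  have hser : ∀ z x, x₁ < x → u z x = expSeries A z (a z) x := by
    intro z x hx
    refine eqOn_of_hasDerivAt_schrodinger (a := x₁) (b := max x (x₁ + 1) + 1) hB (lam := z)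
      (x₀ := x₁ + 1) (p := deriv (u z))
      (q := expSeries A z (fun n => (Complex.I * z - n * A) * a z n))
      ⟨hx₂, by linarith [le_max_right x (x₁ + 1)]⟩ (fun t _ => (hu z).hasDerivAt t)
      (fun t _ => (hu z).hasDerivAt_deriv t)
      (fun t ht => hasDerivAt_expSeries (ha z) hs0.le (h1s t ht.1)) (fun t ht => ?_)
      (hu0 z) (hu1 z) ⟨hx, by linarith [le_max_left x (x₁ + 1)]⟩
    have e := expSeries_second_deriv_eq (lam := z) (q := (V t : ℂ)) (x := t) (a := a z) hA.ne' f0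
      hr.le hf ((mul_le_mul_of_nonneg_right hrs (Real.exp_pos _).le).trans_lt (h1s t ht.1))
      (by
        rw [hVF t (hxR.trans ht.1)]
        refine hFs _ ?_
        rw [norm_exp_neg_mul_ofReal]
        exact (hmono t ht.1).trans hxρ)
      hs0.le (ha z) (h1s t ht.1) (fun n hn => by
        rw [ha_def]
        exact outgoingCoeff_recursion f hA.ne' _ hn)
    rw [← e]
    exact hasDerivAt_expSeries (norm_linear_mul_le hA.le (Complex.I * z) (ha z))
      (by positivity) (h2s t ht.1)
  refine ⟨u, f, M, r, s, x₁ + 1, ⟨fun z => ⟨hu z, fun w => ∑' n, a z n * w ^ n, ?_, ?_, ?_⟩, hue⟩,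
    hue', hM.le, hr, hf, hs, by linarith, (h4 _ hx₂).le, ?_, ?_⟩
  · exact (analyticAt_tsum_mul_pow (ha z) hs0.le (by simp)).1
  · beta_reduce
    rw [tsum_eq_single 0 (fun n hn => by simp [hn])]
    rw [ha_def]
    simp [outgoingCoeff_zero]
  · filter_upwards [eventually_gt_atTop x₁] with x hx
    exact hser z x hx
  · intro z
    rw [hu0 z, ha_def]
  · intro z
    rw [hu1 z, ha_def]

/-! ### Asymptotics and uniqueness of outgoing solutions -/

lemma tendsto_exp_neg_mul_atTop {A : ℝ} (hA : 0 < A) :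
    Tendsto (fun x : ℝ => Complex.exp (-(A * x))) atTop (𝓝 0) := by
  rw [tendsto_zero_iff_norm_tendsto_zero]
  simp_rw [norm_exp_neg_mul_ofReal]
  exact Real.tendsto_exp_neg_atTop_nhds_zero.comp (tendsto_id.const_mul_atTop hA)

lemma IsOutgoingAtTop.tendsto {V : ℝ → ℝ} {A : ℝ} (hA : 0 < A) {lam c : ℂ} {u : ℝ → ℂ}
    (h : IsOutgoingAtTop V A lam c u) :
    Tendsto (fun x : ℝ => Complex.exp (-(Complex.I * lam * x)) * u x) atTop (𝓝 c) ∧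
      Tendsto (fun x : ℝ => Complex.exp (-(Complex.I * lam * x)) * deriv u x) atTop
        (𝓝 (Complex.I * lam * c)) := by
  obtain ⟨hs, v, hv, rfl, hu⟩ := h
  have hw := tendsto_exp_neg_mul_atTop hA
  have hvw : Tendsto (fun x : ℝ => v (Complex.exp (-(A * x)))) atTop (𝓝 (v 0)) :=
    hv.continuousAt.tendsto.comp hw
  constructor
  · refine hvw.congr' ?_
    filter_upwards [hu] with x hx
    rw [hx, ← mul_assoc, ← Complex.exp_add, neg_add_cancel, Complex.exp_zero, one_mul]
  · have hdw : Tendsto (fun x : ℝ => deriv v (Complex.exp (-(A * x)))) atTop (𝓝 (deriv v 0)) :=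
      hv.deriv.continuousAt.tendsto.comp hw
    have hlim := (hvw.const_mul (Complex.I * lam)).sub ((hdw.mul hw).const_mul (A : ℂ))
    rw [mul_zero, mul_zero, sub_zero] at hlim
    refine hlim.congr' ?_
    obtain ⟨N, hN⟩ := eventually_atTop.1 hu
    filter_upwards [eventually_gt_atTop N, hw.eventually hv.eventually_analyticAt] with x hx hvx
    have e1 : HasDerivAt (fun z : ℂ => Complex.exp (-(A * z)))
        (Complex.exp (-(A * x)) * -A) x := by
      have : HasDerivAt (fun z : ℂ => -(A * z)) (-A) x := by
        simpa using ((hasDerivAt_id (x : ℂ)).const_mul (A : ℂ)).fun_neg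
      exact this.cexp
    have e2 : HasDerivAt (fun z : ℂ => Complex.exp (Complex.I * lam * z))
        (Complex.exp (Complex.I * lam * x) * (Complex.I * lam)) x := by
      have : HasDerivAt (fun z : ℂ => Complex.I * lam * z) (Complex.I * lam) x := by
        simpa using (hasDerivAt_id (x : ℂ)).const_mul (Complex.I * lam)
      exact this.cexp
    have e3 := (e2.mul (hvx.differentiableAt.hasDerivAt.comp (x : ℂ) e1)).comp_ofReal
    have e4 : (fun y : ℝ => Complex.exp (Complex.I * lam * y) *
        v (Complex.exp (-(A * y)))) =ᶠ[𝓝 x] u := by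
      filter_upwards [Ioi_mem_nhds hx] with y hy
      exact (hN y (le_of_lt hy)).symm
    rw [← e4.deriv_eq]
    have e5 := e3.deriv
    simp only [Function.comp_apply, Pi.mul_apply] at e5
    rw [e5]
    have : Complex.exp (-(Complex.I * lam * x)) * Complex.exp (Complex.I * lam * x) = 1 := by
      rw [← Complex.exp_add, neg_add_cancel, Complex.exp_zero]
    linear_combination (-(Complex.I * lam * v (Complex.exp (-(A * x))) -
      A * (deriv v (Complex.exp (-(A * x))) * Complex.exp (-(A * x))))) * this

lemma tendsto_exp_I_mul_atTop {lam : ℂ} (h : 0 < lam.im) :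
    Tendsto (fun x : ℝ => Complex.exp (Complex.I * lam * x)) atTop (𝓝 0) := by
  rw [tendsto_zero_iff_norm_tendsto_zero]
  have : ∀ x : ℝ, ‖Complex.exp (Complex.I * lam * x)‖ = Real.exp (-(lam.im * x)) := fun x => by
    rw [Complex.norm_exp]
    simp
  simp_rw [this]
  exact Real.tendsto_exp_neg_atTop_nhds_zero.comp (tendsto_id.const_mul_atTop h)

lemma tendsto_zero_of_exp_mul {lam c : ℂ} (h : 0 < lam.im) {u : ℝ → ℂ}
    (hu : Tendsto (fun x : ℝ => Complex.exp (-(Complex.I * lam * x)) * u x) atTop (𝓝 c)) :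
    Tendsto u atTop (𝓝 0) := by
  have := (tendsto_exp_I_mul_atTop h).mul hu
  rw [zero_mul] at this
  refine this.congr fun x => ?_
  rw [← mul_assoc, ← Complex.exp_add, add_neg_cancel, Complex.exp_zero, one_mul]

lemma SolvesSchrodinger.wronskianAt_eq {V : ℝ → ℝ} {lam : ℂ} {u v : ℝ → ℂ}
    (hu : SolvesSchrodinger V lam u) (hv : SolvesSchrodinger V lam v) (x y : ℝ) :
    wronskianAt u v x = wronskianAt u v y := by
  have hd : ∀ x, HasDerivAt (wronskianAt u v) 0 x := fun x => by
    refine (((hu.hasDerivAt_deriv x).mul (hv.hasDerivAt x)).sub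
      ((hu.hasDerivAt x).mul (hv.hasDerivAt_deriv x))).congr_deriv ?_
    ring
  exact is_const_of_deriv_eq_zero (fun x => (hd x).differentiableAt) (fun x => (hd x).deriv) x y

lemma SolvesSchrodinger.const_mul {V : ℝ → ℝ} (hV : Continuous V) {lam : ℂ} {u : ℝ → ℂ}
    (hu : SolvesSchrodinger V lam u) (k : ℂ) : SolvesSchrodinger V lam fun x => k * u x :=
  solvesSchrodinger_of_hasDerivAt hV (fun x => (hu.hasDerivAt x).const_mul k) fun x =>
    ((hu.hasDerivAt_deriv x).const_mul k).congr_deriv (by ring)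

/-- Solutions with vanishing Wronskian are proportional. -/
lemma SolvesSchrodinger.eq_const_mul {V : ℝ → ℝ} (hV : Continuous V) {B : ℝ}
    (hB : ∀ x, |V x| ≤ B) {lam : ℂ} {u v : ℝ → ℂ}
    (hu : SolvesSchrodinger V lam u) (hv : SolvesSchrodinger V lam v) {x₁ : ℝ} (hx : v x₁ ≠ 0)
    {x₀ : ℝ} (hW : wronskianAt u v x₀ = 0) : ∃ k, ∀ x, u x = k * v x := by
  refine ⟨u x₁ / v x₁, fun x => ?_⟩
  refine congrFun (hu.eq_of_eq hB (hv.const_mul hV (u x₁ / v x₁)) (x₀ := x₁) ?_ ?_) x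
  · field_simp
  · have h := hu.wronskianAt_eq hv x₁ x₀
    rw [hW, wronskianAt, sub_eq_zero] at h
    rw [((hv.hasDerivAt x₁).const_mul _).deriv]
    field_simp
    exact h

lemma IsOutgoingAtTop.eq_of_im_pos {V : ℝ → ℝ} (hV : Continuous V) {B : ℝ}
    (hB : ∀ x, |V x| ≤ B) {A : ℝ} (hA : 0 < A) {lam c : ℂ} (hc : c ≠ 0) (hlam : 0 < lam.im)
    {u v : ℝ → ℂ} (hu : IsOutgoingAtTop V A lam c u) (hv : IsOutgoingAtTop V A lam c v) :
    u = v := by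
  obtain ⟨hu0, hu1⟩ := hu.tendsto hA
  obtain ⟨hv0, hv1⟩ := hv.tendsto hA
  have hW : Tendsto (wronskianAt u v) atTop (𝓝 0) := by
    have := ((tendsto_zero_of_exp_mul hlam hu1).mul (tendsto_zero_of_exp_mul hlam hv0)).sub
      ((tendsto_zero_of_exp_mul hlam hu0).mul (tendsto_zero_of_exp_mul hlam hv1))
    rw [zero_mul, sub_zero] at this
    exact this
  have hW0 : wronskianAt u v 0 = 0 := by
    refine tendsto_nhds_unique (tendsto_const_nhds.congr fun x => ?_) hW
    exact hu.1.wronskianAt_eq hv.1 0 x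
  obtain ⟨x₁, hx₁⟩ := (hv0.eventually_ne hc).exists
  obtain ⟨k, hk⟩ := hu.1.eq_const_mul hV hB hv.1 (right_ne_zero_of_mul hx₁) hW0
  have hk1 : c = k * c := by
    refine tendsto_nhds_unique hu0 ((hv0.const_mul k).congr fun x => ?_)
    rw [hk x]
    ring
  ext x
  rw [hk x, (mul_eq_right₀ hc).1 hk1.symm, one_mul]

lemma inv_Gamma_ne_zero {A : ℝ} (hA : 0 < A) {lam : ℂ} (h : -(A / 2) < lam.im) :
    (Complex.Gamma (1 - 2 * Complex.I * lam / A))⁻¹ ≠ 0 := by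
  refine inv_ne_zero (Complex.Gamma_ne_zero_of_re_pos ?_)
  have : (1 - 2 * Complex.I * lam / A).re = 1 + 2 * lam.im / A := by
    rw [Complex.sub_re, Complex.div_ofReal_re]
    simp
    ring
  rw [this]
  have : -1 < 2 * lam.im / A := by
    rw [lt_div_iff₀ hA]
    linarith
  linarith

/-- The decaying solutions at `Im lam > 0` are determined by their normalization; the rest follows
by analytic continuation. -/
theorem IsOutgoingFamilyPlus.unique {V : ℝ → ℝ} {A : ℝ} (h : IsExpAnalyticAtTop V A)
    {u v : ℂ → ℝ → ℂ} (hu : IsOutgoingFamilyPlus V A u) (hv : IsOutgoingFamilyPlus V A v) :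
    u = v := by
  obtain ⟨B, hB⟩ := h.bounded
  suffices ∀ x, (fun z => u z x) = fun z => v z x by
    ext z x
    exact congrFun (this x) z
  intro x
  refine AnalyticOnNhd.eq_of_eventuallyEq (𝕜 := ℂ) (z₀ := Complex.I)
    (fun z _ => (hu.entire x).analyticAt z) (fun z _ => (hv.entire x).analyticAt z) ?_
  have hopen : IsOpen {z : ℂ | 0 < z.im} := isOpen_lt continuous_const Complex.continuous_im
  filter_upwards [hopen.mem_nhds (by simp : Complex.I ∈ {z : ℂ | 0 < z.im})] with z hz
  have hz' : 0 < z.im := hz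
  have hc := inv_Gamma_ne_zero h.pos (by linarith [h.pos] : -(A / 2) < z.im)
  exact congrFun ((hu.outgoing z).eq_of_im_pos h.continuous hB h.pos hc hz (hv.outgoing z)) x

/-! ### Conjugation and reflection -/

open ComplexConjugate in
lemma IsOutgoingFamilyPlus.conj {V : ℝ → ℝ} {A : ℝ} (h : IsExpAnalyticAtTop V A)
    {u : ℂ → ℝ → ℂ} (hu : IsOutgoingFamilyPlus V A u) (z : ℂ) (x : ℝ) :
    u z x = conj (u (-conj z) x) := by
  have hfam : IsOutgoingFamilyPlus V A fun z x => conj (u (-conj z) x) := by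
    refine ⟨fun z => ⟨?_, ?_⟩, fun x => ?_⟩
    · have hs := (hu.outgoing (-conj z)).1
      refine solvesSchrodinger_of_hasDerivAt h.continuous
        (p := fun x => conj (deriv (u (-conj z)) x)) (fun x => ?_) fun x => ?_
      · exact Complex.conjCLE.hasFDerivAt.comp_hasDerivAt x (hs.hasDerivAt x)
      · have := Complex.conjCLE.hasFDerivAt.comp_hasDerivAt x (hs.hasDerivAt_deriv x)
        refine this.congr_deriv ?_
        simp
    · obtain ⟨v, hv, hv0, he⟩ := (hu.outgoing (-conj z)).2
      refine ⟨fun w => conj (v (conj w)), ?_, ?_, ?_⟩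
      · obtain ⟨s, hs, hd⟩ := hv.exists_mem_nhds_analyticOnNhd
        rw [Complex.analyticAt_iff_eventually_differentiableAt]
        have hc : Tendsto (fun w : ℂ => conj w) (𝓝 0) (𝓝 0) := by
          simpa using Complex.continuous_conj.tendsto (0 : ℂ)
        filter_upwards [hc hs] with w hw
        have := (hd _ hw).differentiableAt.conj_conj
        simpa [Function.comp_def] using this
      · simp only [map_zero, hv0, map_inv₀, ← Complex.Gamma_conj]
        simp [map_ofNat]
      · filter_upwards [he] with x hx
        rw [hx, map_mul, ← Complex.exp_conj, ← Complex.exp_conj]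
        simp
    · intro z
      have h1 : DifferentiableAt ℂ (fun w => u (-w) x) (conj z) :=
        ((hu.entire x).comp differentiable_neg) _
      have := h1.conj_conj
      simpa [Function.comp_def] using this
  exact congrFun (congrFun (hu.unique h hfam) z) x

lemma SolvesSchrodinger.comp_neg {V : ℝ → ℝ} {lam : ℂ} {u : ℝ → ℂ}
    (hu : SolvesSchrodinger V lam u) :
    SolvesSchrodinger (fun x => V (-x)) lam fun x => u (-x) := by
  refine ⟨hu.1.comp contDiff_neg, fun x => ?_⟩
  have := hu.2 (-x)
  rw [iteratedDeriv_comp_neg]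
  simpa using this

lemma isOutgoingFamilyMinus_iff {V : ℝ → ℝ} {A : ℝ} {u : ℂ → ℝ → ℂ} :
    IsOutgoingFamilyMinus V A u ↔
      IsOutgoingFamilyPlus (fun x => V (-x)) A fun z x => u z (-x) := by
  constructor
  · intro h
    refine ⟨fun z => ⟨(h.outgoing z).1.comp_neg, ?_⟩, fun x => h.entire (-x)⟩
    obtain ⟨v, hv, hv0, he⟩ := (h.outgoing z).2
    refine ⟨v, hv, hv0, ?_⟩
    filter_upwards [tendsto_neg_atTop_atBot.eventually he] with x hx
    rw [hx]
    simp
  · intro h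
    refine ⟨fun z => ⟨by simpa using (h.outgoing z).1.comp_neg, ?_⟩,
      fun x => by simpa using h.entire (-x)⟩
    obtain ⟨v, hv, hv0, he⟩ := (h.outgoing z).2
    refine ⟨v, hv, hv0, ?_⟩
    filter_upwards [tendsto_neg_atBot_atTop.eventually he] with x hx
    rw [neg_neg] at hx
    rw [hx]
    simp

/-! ### Zeros of the Wronskian in the closed upper half-plane -/

lemma eq_zero_of_monotone_of_tendsto {g : ℝ → ℝ} (hg : Monotone g)
    (ht : Tendsto g atTop (𝓝 0)) (hb : Tendsto g atBot (𝓝 0)) (x : ℝ) : g x = 0 :=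
  le_antisymm (hg.ge_of_tendsto ht x) (hg.le_of_tendsto hb x)

open ComplexConjugate in
lemma SolvesSchrodinger.hasDerivAt_flux {V : ℝ → ℝ} {lam : ℂ} {u : ℝ → ℂ}
    (hu : SolvesSchrodinger V lam u) (x : ℝ) :
    HasDerivAt (fun x => deriv u x * conj (u x))
      (((V x : ℂ) - lam ^ 2) * Complex.normSq (u x) + Complex.normSq (deriv u x)) x := by
  have h1 := Complex.conjCLE.hasFDerivAt.comp_hasDerivAt x (hu.hasDerivAt x)
  refine ((hu.hasDerivAt_deriv x).mul h1).congr_deriv ?_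
  simp only [Function.comp_apply, ContinuousLinearEquiv.coe_coe, Complex.conjCLE_apply]
  rw [← Complex.mul_conj, ← Complex.mul_conj]
  ring

open ComplexConjugate in
/-- A nonzero solution that decays at both ends has `lam² ∈ [-B, ∞)`: the flux `u' conj u` vanishes
at both ends, and its imaginary, respectively real, part is monotone otherwise. -/
lemma SolvesSchrodinger.sq_of_tendsto_zero {V : ℝ → ℝ} {B : ℝ} (hB : ∀ x, |V x| ≤ B) {lam : ℂ}
    {u : ℝ → ℂ} (hu : SolvesSchrodinger V lam u) {x₀ : ℝ} (hx₀ : u x₀ ≠ 0)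
    (ht : Tendsto u atTop (𝓝 0)) (ht' : Tendsto (deriv u) atTop (𝓝 0))
    (hb : Tendsto u atBot (𝓝 0)) (hb' : Tendsto (deriv u) atBot (𝓝 0)) :
    (lam ^ 2).im = 0 ∧ -B ≤ (lam ^ 2).re := by
  have hft : Tendsto (fun x => deriv u x * conj (u x)) atTop (𝓝 0) := by
    simpa using ht'.mul ((Complex.continuous_conj.tendsto 0).comp ht)
  have hfb : Tendsto (fun x => deriv u x * conj (u x)) atBot (𝓝 0) := by
    simpa using hb'.mul ((Complex.continuous_conj.tendsto 0).comp hb)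
  have him : ∀ x, HasDerivAt (fun x => (deriv u x * conj (u x)).im)
      (-(lam ^ 2).im * Complex.normSq (u x)) x := fun x => by
    have := Complex.imCLM.hasFDerivAt.comp_hasDerivAt x (hu.hasDerivAt_flux x)
    refine this.congr_deriv ?_
    simp [-map_pow, Complex.mul_im, -mul_eq_zero]
  have hre : ∀ x, HasDerivAt (fun x => (deriv u x * conj (u x)).re)
      ((V x - (lam ^ 2).re) * Complex.normSq (u x) + Complex.normSq (deriv u x)) x := fun x => by
    have := Complex.reCLM.hasFDerivAt.comp_hasDerivAt x (hu.hasDerivAt_flux x)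
    refine this.congr_deriv ?_
    simp [-map_pow, Complex.mul_re]
  have himt : Tendsto (fun x => (deriv u x * conj (u x)).im) atTop (𝓝 0) := by
    rw [← Complex.zero_im]
    exact (Complex.continuous_im.tendsto 0).comp hft
  have himb : Tendsto (fun x => (deriv u x * conj (u x)).im) atBot (𝓝 0) := by
    rw [← Complex.zero_im]
    exact (Complex.continuous_im.tendsto 0).comp hfb
  have hret : Tendsto (fun x => (deriv u x * conj (u x)).re) atTop (𝓝 0) := by
    rw [← Complex.zero_re]
    exact (Complex.continuous_re.tendsto 0).comp hft
  have hreb : Tendsto (fun x => (deriv u x * conj (u x)).re) atBot (𝓝 0) := by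
    rw [← Complex.zero_re]
    exact (Complex.continuous_re.tendsto 0).comp hfb
  have hpos : 0 < Complex.normSq (u x₀) := Complex.normSq_pos.2 hx₀
  constructor
  · have key : ∀ x, (deriv u x * conj (u x)).im = 0 := by
      rcases le_total (lam ^ 2).im 0 with h | h
      · refine eq_zero_of_monotone_of_tendsto (monotone_of_hasDerivAt_nonneg him fun x => ?_)
          himt himb
        exact mul_nonneg (by linarith) (Complex.normSq_nonneg _)
      · intro x
        have := eq_zero_of_monotone_of_tendsto (monotone_of_hasDerivAt_nonneg
          (fun x => (him x).fun_neg) fun x => ?_) (by simpa using himt.neg)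
          (by simpa using himb.neg) x
        · exact neg_eq_zero.1 this
        · rw [Pi.zero_apply, neg_mul, neg_neg]
          exact mul_nonneg h (Complex.normSq_nonneg _)
    have h0 := (him x₀).unique ((hasDerivAt_const x₀ (0 : ℝ)).congr_of_eventuallyEq
      (Eventually.of_forall key))
    rcases mul_eq_zero.1 h0 with h | h
    · linarith
    · exact absurd h hpos.ne'
  · by_contra! hlt
    have hV : ∀ x, 0 < V x - (lam ^ 2).re := fun x => by
      have := (abs_le.1 (hB x)).1
      linarith
    have key := eq_zero_of_monotone_of_tendsto (monotone_of_hasDerivAt_nonneg hre fun x =>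
      add_nonneg (mul_nonneg (hV x).le (Complex.normSq_nonneg _)) (Complex.normSq_nonneg _))
      hret hreb
    have h0 := (hre x₀).unique ((hasDerivAt_const x₀ (0 : ℝ)).congr_of_eventuallyEq
      (Eventually.of_forall key))
    have := mul_pos (hV x₀) hpos
    have := Complex.normSq_nonneg (deriv u x₀)
    linarith

open ComplexConjugate in
lemma tendsto_flux_im {lam c : ℂ} (hlam : lam.im = 0) {u : ℝ → ℂ}
    (h0 : Tendsto (fun x : ℝ => Complex.exp (-(Complex.I * lam * x)) * u x) atTop (𝓝 c))
    (h1 : Tendsto (fun x : ℝ => Complex.exp (-(Complex.I * lam * x)) * deriv u x) atTop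
      (𝓝 (Complex.I * lam * c))) :
    Tendsto (fun x => (deriv u x * conj (u x)).im) atTop (𝓝 (lam.re * Complex.normSq c)) := by
  have h2 := (Complex.continuous_im.tendsto _).comp
    (h1.mul ((Complex.continuous_conj.tendsto c).comp h0))
  have e : (Complex.I * lam * c * conj c).im = lam.re * Complex.normSq c := by
    rw [mul_assoc, Complex.mul_conj]
    simp
  rw [e] at h2
  refine h2.congr fun x => ?_
  have hn : Complex.exp (-(Complex.I * lam * x)) * conj (Complex.exp (-(Complex.I * lam * x))) =
      1 := by
    rw [Complex.mul_conj, Complex.normSq_eq_norm_sq, Complex.norm_exp]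
    simp [hlam]
  simp only [Function.comp_apply, map_mul]
  congr 1
  linear_combination (deriv u x * conj (u x)) * hn

open ComplexConjugate in
/-- A solution outgoing at both ends, for `lam` in the closed upper half-plane, has `lam = i y` with
`0 ≤ y ≤ B + 1`. For real `lam` the conserved flux is `lam |c|²` at `+∞` and has the opposite sign
at `-∞`. Here `v` is the reflection of the solution outgoing at `-∞`. -/
lemma exists_eq_I_mul_of_outgoing {V : ℝ → ℝ} {B : ℝ}
    (hB : ∀ x, |V x| ≤ B) {A A' : ℝ} (hA : 0 < A) (hA' : 0 < A') {lam c c' k : ℂ} (hc : c ≠ 0)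
    {u v : ℝ → ℂ} (hu : IsOutgoingAtTop V A lam c u)
    (hv : IsOutgoingAtTop (fun x => V (-x)) A' lam c' v) (hk : ∀ x, u x = k * v (-x))
    (hlam : 0 ≤ lam.im) : ∃ y ∈ Set.Icc (0 : ℝ) (B + 1), lam = Complex.I * y := by
  obtain ⟨hu0, hu1⟩ := hu.tendsto hA
  obtain ⟨hv0, hv1⟩ := hv.tendsto hA'
  have hB0 : 0 ≤ B := (abs_nonneg _).trans (hB 0)
  have hdk : ∀ x, deriv u x = -(k * deriv v (-x)) := fun x => by
    have h1 : HasDerivAt (fun x : ℝ => v (-x)) (-deriv v (-x)) x := by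
      simpa [Function.comp_def] using (hv.1.hasDerivAt (-x)).scomp x (hasDerivAt_neg x)
    rw [show u = fun x => k * v (-x) from funext hk, (h1.const_mul k).deriv]
    ring
  have hre0 : lam = Complex.I * lam.im ↔ lam.re = 0 := by
    rw [Complex.ext_iff]
    simp
  rcases hlam.eq_or_lt with h0 | hpos
  · refine ⟨0, ⟨le_rfl, by linarith⟩, ?_⟩
    have hre : lam.re = 0 := by
      have hconst : ∀ x y, (deriv u x * conj (u x)).im = (deriv u y * conj (u y)).im := by
        have him : ∀ x, HasDerivAt (fun x => (deriv u x * conj (u x)).im) 0 x := fun x => by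
          have := Complex.imCLM.hasFDerivAt.comp_hasDerivAt x (hu.1.hasDerivAt_flux x)
          refine this.congr_deriv ?_
          simp [pow_two, ← h0]
        exact is_const_of_deriv_eq_zero (fun x => (him x).differentiableAt)
          fun x => (him x).deriv
      have e1 : (deriv u 0 * conj (u 0)).im = lam.re * Complex.normSq c :=
        tendsto_nhds_unique (tendsto_const_nhds.congr fun x => hconst 0 x)
          (tendsto_flux_im h0.symm hu0 hu1)
      have e2 : -(deriv u 0 * conj (u 0)).im =
          Complex.normSq k * (lam.re * Complex.normSq c') := by
        refine tendsto_nhds_unique (tendsto_const_nhds.congr fun x => ?_)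
          ((tendsto_flux_im h0.symm hv0 hv1).const_mul (Complex.normSq k))
        rw [hconst 0 (-x), hk, hdk, neg_neg, map_mul,
          show -(k * deriv v x) * (conj k * conj (v x)) =
            -(Complex.normSq k * (deriv v x * conj (v x))) by rw [← Complex.mul_conj]; ring,
          Complex.neg_im, neg_neg, Complex.im_ofReal_mul]
      have h1 : 0 < Complex.normSq c := Complex.normSq_pos.2 hc
      have h2 : 0 ≤ Complex.normSq k * Complex.normSq c' :=
        mul_nonneg (Complex.normSq_nonneg _) (Complex.normSq_nonneg _)
      have h3 : lam.re * (Complex.normSq c + Complex.normSq k * Complex.normSq c') = 0 := by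
        linarith
      rcases mul_eq_zero.1 h3 with h | h
      · exact h
      · linarith
    have := hre0.2 hre
    rw [← h0] at this
    exact this
  · obtain ⟨x₀, hx₀⟩ := (hu0.eventually_ne hc).exists
    have hu0' := tendsto_zero_of_exp_mul hpos hu0
    have hu1' := tendsto_zero_of_exp_mul hpos hu1
    have hv0' := tendsto_zero_of_exp_mul hpos hv0
    have hv1' := tendsto_zero_of_exp_mul hpos hv1
    have hub : Tendsto u atBot (𝓝 0) := by
      have := (hv0'.comp tendsto_neg_atBot_atTop).const_mul k
      rw [mul_zero] at this
      exact this.congr fun x => (hk x).symm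
    have hub' : Tendsto (deriv u) atBot (𝓝 0) := by
      have := ((hv1'.comp tendsto_neg_atBot_atTop).const_mul k).neg
      rw [mul_zero, neg_zero] at this
      exact this.congr fun x => (hdk x).symm
    obtain ⟨him, hre⟩ := hu.1.sq_of_tendsto_zero hB (right_ne_zero_of_mul hx₀) hu0' hu1' hub hub'
    simp only [pow_two, Complex.mul_im, Complex.mul_re] at him hre
    have hre' : lam.re = 0 := by
      have : lam.re * lam.im = 0 := by linarith
      exact (mul_eq_zero.1 this).resolve_right hpos.ne'
    refine ⟨lam.im, ⟨hlam, ?_⟩, hre0.2 hre'⟩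
    rw [hre'] at hre
    nlinarith

/-! ### Bounds for the Cauchy data at the origin -/

/-- Backward propagation in the energy norm `max ((1 + ‖lam‖) ‖u‖, ‖u'‖)`, whose growth rate is
linear in `‖lam‖`. -/
lemma SolvesSchrodinger.norm_zero_le {V : ℝ → ℝ} {B : ℝ} (hB : ∀ x, |V x| ≤ B) {lam : ℂ}
    {u : ℝ → ℂ} (hu : SolvesSchrodinger V lam u) {L : ℝ} (hL : 0 ≤ L) :
    ‖u 0‖ ≤ Real.exp ((1 + ‖lam‖ + B) * L) * ((1 + ‖lam‖) * ‖u L‖ + ‖deriv u L‖) ∧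
      ‖deriv u 0‖ ≤ Real.exp ((1 + ‖lam‖ + B) * L) * ((1 + ‖lam‖) * ‖u L‖ + ‖deriv u L‖) := by
  have hB0 : 0 ≤ B := (abs_nonneg _).trans (hB 0)
  obtain ⟨k, hk⟩ : ∃ k : ℝ, k = 1 + ‖lam‖ := ⟨_, rfl⟩
  have hk1 : 1 ≤ k := by rw [hk]; linarith [norm_nonneg lam]
  have hkn : ‖(k : ℂ)‖ = k := by rw [Complex.norm_real, Real.norm_of_nonneg (by linarith)]
  have key := (norm_sub_le_of_norm_deriv_le_mul (y := fun x => ((k : ℂ) * u x, deriv u x))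
    (y' := fun x => ((k : ℂ) * deriv u x, ((V x : ℂ) - lam ^ 2) * u x)) (K := k + B) (L := L) hL
    (by linarith) (fun x _ => ((hu.hasDerivAt x).const_mul _).prodMk (hu.hasDerivAt_deriv x))
    fun x _ => ?_).1
  · have h1 : ‖((k : ℂ) * u L, deriv u L)‖ ≤ k * ‖u L‖ + ‖deriv u L‖ := by
      rw [Prod.norm_mk, norm_mul, hkn]
      exact max_le_add_of_nonneg (by positivity) (norm_nonneg _)
    have h2 := key.trans (mul_le_mul_of_nonneg_left h1 (Real.exp_pos _).le)
    rw [Prod.norm_mk, norm_mul, hkn] at h2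
    rw [← hk]
    refine ⟨le_trans ?_ ((le_max_left _ _).trans h2), (le_max_right _ _).trans h2⟩
    exact le_mul_of_one_le_left (norm_nonneg _) hk1
  · have h1 : k * ‖u x‖ ≤ ‖((k : ℂ) * u x, deriv u x)‖ := by
      rw [Prod.norm_mk, norm_mul, hkn]
      exact le_max_left _ _
    have h2 : ‖deriv u x‖ ≤ ‖((k : ℂ) * u x, deriv u x)‖ := by
      rw [Prod.norm_mk]
      exact le_max_right _ _
    have hV : ‖(V x : ℂ) - lam ^ 2‖ ≤ (k + B) * k := by
      refine (norm_sub_le _ _).trans ?_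
      rw [norm_pow, Complex.norm_real, Real.norm_eq_abs]
      have := hB x
      nlinarith [norm_nonneg lam]
    rw [Prod.norm_mk, norm_mul, norm_mul, hkn]
    refine max_le ?_ ?_
    · nlinarith [norm_nonneg ((k : ℂ) * u x, deriv u x)]
    · calc _ ≤ (k + B) * k * ‖u x‖ := by gcongr
        _ = (k + B) * (k * ‖u x‖) := by ring
        _ ≤ _ := by gcongr

/-- Along a bounded interval and for `lam` in a strip, the amplitudes
`exp (∓ i lam x) (u' ± i lam u)` vary by a relative amount `O (1 / ‖lam‖)`. -/
lemma SolvesSchrodinger.norm_amplitude_sub_le {V : ℝ → ℝ} {B : ℝ} (hB : ∀ x, |V x| ≤ B) {lam : ℂ}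
    {u : ℝ → ℂ} (hu : SolvesSchrodinger V lam u) {L k : ℝ} (hL : 0 ≤ L) (hlam : |lam.im| ≤ 1)
    (h0 : lam ≠ 0) {y : ℝ → ℂ × ℂ} (hk : k = Real.exp L * Real.exp L * B / ‖lam‖)
    (hy : y = fun x : ℝ =>
      (Complex.exp (-(Complex.I * lam * x)) * (deriv u x + Complex.I * lam * u x),
        Complex.exp (Complex.I * lam * x) * (deriv u x - Complex.I * lam * u x))) :
    ‖y 0 - y L‖ ≤ k * L * Real.exp (k * L) * ‖y L‖ := by
  have hB0 : 0 ≤ B := (abs_nonneg _).trans (hB 0)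
  have hn0 : 0 < ‖lam‖ := norm_pos_iff.2 h0
  have hE : ∀ x ∈ Icc 0 L, ‖Complex.exp (Complex.I * lam * x)‖ ≤ Real.exp L ∧
      ‖Complex.exp (-(Complex.I * lam * x))‖ ≤ Real.exp L := fun x hx => by
    obtain ⟨h1, h2⟩ := abs_le.1 hlam
    rw [Complex.norm_exp, Complex.norm_exp]
    constructor <;>
    · refine Real.exp_le_exp.2 ?_
      simp
      nlinarith [hx.1, hx.2]
  have hexp : ∀ (c : ℂ) (x : ℝ), HasDerivAt (fun x : ℝ => Complex.exp (c * x))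
      (Complex.exp (c * x) * c) x := fun c x => by
    have : HasDerivAt (fun z : ℂ => c * z) c x := by
      simpa using (hasDerivAt_id (x : ℂ)).const_mul c
    exact this.cexp.comp_ofReal
  refine (norm_sub_le_of_norm_deriv_le_mul (y := y) (y' := fun x =>
    (Complex.exp (-(Complex.I * lam * x)) * (V x * u x),
      Complex.exp (Complex.I * lam * x) * (V x * u x))) hL (by rw [hk]; positivity)
    (fun x _ => ?_) fun x hx => ?_).2
  · rw [hy]
    have h1 := (hexp (-(Complex.I * lam)) x).mul
      ((hu.hasDerivAt_deriv x).add ((hu.hasDerivAt x).const_mul (Complex.I * lam)))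
    have h2 := (hexp (Complex.I * lam) x).mul
      ((hu.hasDerivAt_deriv x).sub ((hu.hasDerivAt x).const_mul (Complex.I * lam)))
    simp_rw [neg_mul (Complex.I * lam)] at h1
    refine (h1.congr_deriv ?_).prodMk (h2.congr_deriv ?_)
    · simp only [Pi.add_apply]
      linear_combination (-Complex.exp (-(Complex.I * lam * x)) * lam ^ 2 * u x) * Complex.I_sq
    · simp only [Pi.sub_apply]
      linear_combination (-Complex.exp (Complex.I * lam * x) * lam ^ 2 * u x) * Complex.I_sq
  · obtain ⟨e1, e2⟩ := hE x hx
    have hinv : Complex.exp (Complex.I * lam * x) * Complex.exp (-(Complex.I * lam * x)) = 1 := by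
      rw [← Complex.exp_add, add_neg_cancel, Complex.exp_zero]
    -- The solution is recovered from the two amplitudes.
    have hrec : 2 * Complex.I * lam * u x =
        Complex.exp (Complex.I * lam * x) * (y x).1 -
          Complex.exp (-(Complex.I * lam * x)) * (y x).2 := by
      rw [hy]
      linear_combination (-(2 * Complex.I * lam * u x)) * hinv
    have hun : ‖u x‖ ≤ Real.exp L * ‖y x‖ / ‖lam‖ := by
      rw [le_div_iff₀ hn0]
      have h1 := congrArg norm hrec
      have h2 := norm_sub_le (Complex.exp (Complex.I * lam * x) * (y x).1)
        (Complex.exp (-(Complex.I * lam * x)) * (y x).2)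
      rw [← h1, norm_mul, norm_mul, norm_mul, norm_mul, norm_mul, Complex.norm_I] at h2
      have h3 := mul_le_mul e1 (norm_fst_le (y x)) (norm_nonneg _) (Real.exp_pos L).le
      have h4 := mul_le_mul e2 (norm_snd_le (y x)) (norm_nonneg _) (Real.exp_pos L).le
      have h5 : ‖(2 : ℂ)‖ = 2 := by simp
      rw [h5] at h2
      linarith
    have hVu : ‖(V x : ℂ) * u x‖ ≤ B * (Real.exp L * ‖y x‖ / ‖lam‖) := by
      rw [norm_mul, Complex.norm_real]
      exact mul_le_mul (hB x) hun (norm_nonneg _) hB0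
    have hfin : Real.exp L * (B * (Real.exp L * ‖y x‖ / ‖lam‖)) = k * ‖y x‖ := by
      rw [hk]
      ring
    rw [← hfin, Prod.norm_mk, norm_mul (Complex.exp (-(Complex.I * lam * x))),
      norm_mul (Complex.exp (Complex.I * lam * x))]
    exact max_le (mul_le_mul e2 hVu (norm_nonneg _) (Real.exp_pos L).le)
      (mul_le_mul e1 hVu (norm_nonneg _) (Real.exp_pos L).le)

lemma norm_two_I_mul_div {A : ℝ} (hA : 0 < A) (z : ℂ) :
    ‖2 * Complex.I * z / A‖ = 2 * ‖z‖ / A := by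
  rw [norm_div, norm_mul, norm_mul, Complex.norm_I, Complex.norm_real, Real.norm_of_nonneg hA.le]
  simp

lemma IsOutgoingFamilyPlus.differentiable_deriv {V : ℝ → ℝ} {A : ℝ}
    (h : IsExpAnalyticAtTop V A) {u : ℂ → ℝ → ℂ} (hu : IsOutgoingFamilyPlus V A u) (x : ℝ) :
    Differentiable ℂ fun z => deriv (u z) x := by
  obtain ⟨v, -, -, -, -, -, hv, hd, -⟩ := h.exists_family
  rw [hu.unique h hv]
  exact hd x

lemma exp_mul_le_exp_rpow {p C c t : ℝ} (hp : 1 ≤ p) (hc : 0 ≤ c) (ht : 0 ≤ t) :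
    Real.exp (c * (1 + t)) * Real.exp (C * (1 + t) ^ p) ≤
      Real.exp ((c + C) * (1 + t) ^ p) := by
  have : 1 + t ≤ (1 + t) ^ p := by
    simpa using Real.rpow_le_rpow_of_exponent_le (by linarith : 1 ≤ 1 + t) hp
  rw [← Real.exp_add]
  refine Real.exp_le_exp.2 ?_
  nlinarith

/-- The Cauchy data of the outgoing family at the origin have order at most one in `lam`. -/
theorem IsOutgoingFamilyPlus.exists_norm_le {V : ℝ → ℝ} {A : ℝ}
    (h : IsExpAnalyticAtTop V A) {u : ℂ → ℝ → ℂ} (hu : IsOutgoingFamilyPlus V A u)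
    {p : ℝ} (hp1 : 1 < p) (hp2 : p ≤ 2) :
    ∃ C : ℝ, 0 ≤ C ∧ ∀ z, ‖u z 0‖ ≤ Real.exp (C * (1 + ‖z‖) ^ p) ∧
      ‖deriv (u z) 0‖ ≤ Real.exp (C * (1 + ‖z‖) ^ p) := by
  obtain ⟨B, hB⟩ := h.bounded
  have hB0 : 0 ≤ B := (abs_nonneg _).trans (hB 0)
  have hA := h.pos
  obtain ⟨v, f, M, r, s, L, hv, -, hM, hr, hf, hs, hL, hsL, hv0, hv1⟩ := h.exists_family
  obtain rfl := hu.unique h hv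
  have hs0 : 0 ≤ s := by rw [hs]; positivity
  obtain ⟨C, hC, hbd⟩ := exists_norm_outgoingCoeff_le hA.ne' hM hr hf hs hp1 hp2
  have hw := norm_exp_neg_mul_ofReal A L
  have hsL' : s * Real.exp (-(A * L)) ≤ 1 / 2 := by
    have := mul_nonneg hs0 (Real.exp_pos (-(A * L))).le
    linarith
  obtain ⟨b, hb⟩ : ∃ b, b = (1 + 2 / A) ^ p * C := ⟨_, rfl⟩
  have hcoef : ∀ z n, ‖outgoingCoeff f A (2 * Complex.I * z / A) n‖ ≤
      Real.exp (b * (1 + ‖z‖) ^ p) * s ^ n := fun z n => by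
    refine (hbd _ n).trans (mul_le_mul_of_nonneg_right (Real.exp_le_exp.2 ?_) (by positivity))
    rw [norm_two_I_mul_div hA, hb, mul_comm _ C, mul_assoc,
      ← Real.mul_rpow (by positivity) (by positivity)]
    gcongr
    have h1 : 0 ≤ 2 / A := by positivity
    have h2 : 2 * ‖z‖ / A = 2 / A * ‖z‖ := by ring
    rw [h2]
    nlinarith [norm_nonneg z]
  have he : ∀ z : ℂ, ‖Complex.exp (Complex.I * z * L)‖ ≤ Real.exp (L * ‖z‖) := fun z => by
    refine (Complex.norm_exp_le_exp_norm _).trans (Real.exp_le_exp.2 ?_)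
    rw [norm_mul, norm_mul, Complex.norm_I, Complex.norm_real, Real.norm_of_nonneg hL.le]
    linarith
  have hd0 : ∀ z, ‖u z L‖ ≤ Real.exp (L * ‖z‖) * (2 * Real.exp (b * (1 + ‖z‖) ^ p)) :=
    fun z => by
    rw [hv0, expSeries, norm_mul]
    exact mul_le_mul (he z) (norm_tsum_mul_pow_le (hcoef z) hs0 (by rwa [hw])) (norm_nonneg _)
      (Real.exp_pos _).le
  have hd1 : ∀ z, ‖deriv (u z) L‖ ≤
      Real.exp (L * ‖z‖) * (2 * ((‖z‖ + A) * Real.exp (b * (1 + ‖z‖) ^ p))) := fun z => by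
    rw [hv1, expSeries, norm_mul]
    refine mul_le_mul (he z) ?_ (norm_nonneg _) (Real.exp_pos _).le
    have := norm_linear_mul_le hA.le (Complex.I * z) (hcoef z)
    rw [norm_mul, Complex.norm_I, one_mul] at this
    exact norm_tsum_mul_pow_le this (by positivity) (by rwa [hw])
  refine ⟨(1 + B) * L + L + 4 + 2 * A + b, by rw [hb]; positivity, fun z => ?_⟩
  have hz := norm_nonneg z
  have main : Real.exp ((1 + ‖z‖ + B) * L) * ((1 + ‖z‖) * ‖u z L‖ + ‖deriv (u z) L‖) ≤
      Real.exp (((1 + B) * L + L + 4 + 2 * A + b) * (1 + ‖z‖) ^ p) := by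
    have e1 : Real.exp ((1 + ‖z‖ + B) * L) ≤ Real.exp ((1 + B) * L * (1 + ‖z‖)) := by
      refine Real.exp_le_exp.2 ?_
      nlinarith [mul_nonneg (mul_nonneg hB0 hL.le) hz]
    have e2 : (1 + ‖z‖) * ‖u z L‖ + ‖deriv (u z) L‖ ≤ Real.exp (L * ‖z‖) *
        ((4 + 2 * A) * (1 + ‖z‖) * Real.exp (b * (1 + ‖z‖) ^ p)) := by
      have h1 := mul_le_mul_of_nonneg_left (hd0 z) (by positivity : 0 ≤ 1 + ‖z‖)
      have h3 : 0 < Real.exp (L * ‖z‖) * Real.exp (b * (1 + ‖z‖) ^ p) := by positivity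
      calc _ ≤ _ := add_le_add h1 (hd1 z)
        _ = (Real.exp (L * ‖z‖) * Real.exp (b * (1 + ‖z‖) ^ p)) *
            (2 * (1 + ‖z‖) + 2 * (‖z‖ + A)) := by ring
        _ ≤ (Real.exp (L * ‖z‖) * Real.exp (b * (1 + ‖z‖) ^ p)) *
            ((4 + 2 * A) * (1 + ‖z‖)) := by
          gcongr
          nlinarith [mul_nonneg hA.le hz]
        _ = _ := by ring
    have e3 : Real.exp (L * ‖z‖) ≤ Real.exp (L * (1 + ‖z‖)) := by
      gcongr
      linarith
    have e4 : (4 + 2 * A) * (1 + ‖z‖) ≤ Real.exp ((4 + 2 * A) * (1 + ‖z‖)) := by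
      linarith [Real.add_one_le_exp ((4 + 2 * A) * (1 + ‖z‖))]
    calc _ ≤ Real.exp ((1 + B) * L * (1 + ‖z‖)) * (Real.exp (L * (1 + ‖z‖)) *
          (Real.exp ((4 + 2 * A) * (1 + ‖z‖)) * Real.exp (b * (1 + ‖z‖) ^ p))) := by
          refine mul_le_mul e1 (e2.trans ?_) (by positivity) (Real.exp_pos _).le
          gcongr
      _ = Real.exp (((1 + B) * L + L + (4 + 2 * A)) * (1 + ‖z‖)) *
          Real.exp (b * (1 + ‖z‖) ^ p) := by
        rw [← Real.exp_add, ← Real.exp_add, ← Real.exp_add, ← Real.exp_add]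
        ring_nf
      _ ≤ _ := by
        refine (exp_mul_le_exp_rpow hp1.le (by positivity) hz).trans (le_of_eq ?_)
        ring_nf
  obtain ⟨h1, h2⟩ := (hu.outgoing z).1.norm_zero_le hB hL.le
  exact ⟨h1.trans main, h2.trans main⟩

/-- Away from its leading term, the series `∑ (c - n A) aₙ wⁿ` is controlled by the bound on
`aₙ`, `n ≥ 1`. -/
lemma norm_tsum_linear_sub_le {a : ℕ → ℂ} {A D E s : ℝ} (hA : 0 ≤ A) (hs : 0 ≤ s) (c : ℂ)
    (hE : ∀ n, ‖a n‖ ≤ E * s ^ n) (hD : 0 ≤ D) (ha : ∀ n, n ≠ 0 → ‖a n‖ ≤ D * s ^ n) {w : ℂ}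
    (hw : 2 * s * ‖w‖ ≤ 1 / 2) :
    ‖(∑' n : ℕ, ((c - n * A) * a n) * w ^ n) - c * a 0‖ ≤ 2 * ((‖c‖ + A) * D) := by
  have hd : ∀ n, ‖(if n = 0 then 0 else a n : ℂ)‖ ≤ D * s ^ n := fun n => by
    split_ifs with h
    · simp only [norm_zero]
      positivity
    · exact ha n h
  have h1 := norm_linear_mul_le hA c hd
  have h2 := norm_tsum_mul_pow_le h1 (by positivity) hw
  have hw1 : 2 * s * ‖w‖ < 1 := by linarith
  have s1 := (summable_mul_pow h1 (by positivity) hw1).of_norm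
  have s2 := (summable_mul_pow (norm_linear_mul_le hA c hE) (by positivity) hw1).of_norm
  rw [s1.tsum_eq_zero_add] at h2
  rw [s2.tsum_eq_zero_add]
  simpa using h2

/-- At high energy in the strip `|Im lam| ≤ 1` the outgoing family has, at the origin, the Cauchy
data of `v₊(0) exp (i lam x)` up to relative errors `O (1 / |Re lam|)`. -/
theorem IsOutgoingFamilyPlus.exists_norm_amplitude_le {V : ℝ → ℝ} {A : ℝ}
    (h : IsExpAnalyticAtTop V A) {u : ℂ → ℝ → ℂ} (hu : IsOutgoingFamilyPlus V A u) :
    ∃ C : ℝ, 0 ≤ C ∧ ∀ z c : ℂ, c = (Complex.Gamma (1 - 2 * Complex.I * z / A))⁻¹ →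
      |z.im| ≤ 1 → C ≤ |z.re| →
      ‖deriv (u z) 0 + Complex.I * z * u z 0 - 2 * Complex.I * z * c‖ ≤ C * ‖c‖ ∧
      ‖deriv (u z) 0 - Complex.I * z * u z 0‖ ≤ C * ‖c‖ := by
  obtain ⟨B, hB⟩ := h.bounded
  have hB0 : 0 ≤ B := (abs_nonneg _).trans (hB 0)
  have hA := h.pos
  obtain ⟨v, f, M, r, s, L, hv, -, hM, hr, hf, hs, hL, hsL, hv0, hv1⟩ := h.exists_family
  obtain rfl := hu.unique h hv
  have hs0 : 0 ≤ s := by rw [hs]; positivity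
  have hwL := norm_exp_neg_mul_ofReal A L
  obtain ⟨k, hk⟩ : ∃ k, k = Real.exp L * Real.exp L * B := ⟨_, rfl⟩
  have hk0 : 0 ≤ k := by rw [hk]; positivity
  obtain ⟨Q, hQ⟩ : ∃ Q, Q = Real.exp L * Real.exp L * (5 * A) := ⟨_, rfl⟩
  have hQ0 : 0 ≤ Q := by rw [hQ]; positivity
  obtain ⟨T, hT⟩ : ∃ T, T = k * L * Real.exp (k * L) * (2 + 5 * A + Q) := ⟨_, rfl⟩
  have hT0 : 0 ≤ T := by rw [hT]; positivity
  refine ⟨1 + A + 5 * A + Q + T, by positivity, fun z c hc him hre => ?_⟩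
  have hre1 : 1 + A ≤ |z.re| := by linarith
  have hzre := Complex.abs_re_le_norm z
  have hz1 : 1 ≤ ‖z‖ := by linarith
  have hz2 : ‖z‖ ≤ 2 * |z.re| := by
    have := Complex.norm_le_abs_re_add_abs_im z
    linarith
  have hz0 : z ≠ 0 := norm_pos_iff.1 (by linarith)
  obtain ⟨a, ha⟩ : ∃ a, a = outgoingCoeff f A (2 * Complex.I * z / A) := ⟨_, rfl⟩
  have ha0 : a 0 = c := by rw [ha, outgoingCoeff_zero, hc]
  have hκ : 1 / 2 ≤ 2 * |z.re| / A := by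
    rw [le_div_iff₀ hA]
    linarith
  -- All denominators `n - mu` have imaginary part of size `2 |Re z| / A`.
  have hbd := norm_le_of_recursion (a := a) hA.ne' hM hr hf hs
    (fun n hn => by rw [ha]; exact outgoingCoeff_recursion f hA.ne' _ hn) hκ fun j _ => by
      have : ((j : ℂ) - 2 * Complex.I * z / A).im = -(2 * z.re / A) := by
        rw [Complex.sub_im, Complex.div_ofReal_im]
        simp
      have h1 := Complex.abs_im_le_norm ((j : ℂ) - 2 * Complex.I * z / A)
      rw [this, abs_neg, abs_div, abs_mul, abs_of_pos hA, abs_two] at h1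
      exact h1
  rw [ha0] at hbd
  have hE : ∀ n, ‖a n‖ ≤ ‖c‖ * s ^ n := fun n => by
    rw [mul_comm]
    exact (hbd n).1
  have hrepos : 0 < |z.re| := by linarith
  have hD : ∀ n, n ≠ 0 → ‖a n‖ ≤ (A / (4 * |z.re|) * ‖c‖) * s ^ n := fun n hn => by
    have := (hbd n).2 hn
    rw [div_mul_eq_mul_div, div_le_iff₀ hA] at this
    rw [div_mul_eq_mul_div, div_mul_eq_mul_div, le_div_iff₀ (by positivity)]
    linarith
  have hser : ∀ b : ℂ, ‖b‖ ≤ 2 * ‖z‖ →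
      ‖(∑' n : ℕ, ((b - n * A) * a n) * Complex.exp (-(A * L)) ^ n) - b * c‖ ≤
        5 * A * ‖c‖ := fun b hb => by
    rw [← ha0]
    refine (norm_tsum_linear_sub_le hA.le hs0 b hE (by positivity) hD
      (by rwa [hwL])).trans ?_
    rw [ha0]
    have : ‖b‖ + A ≤ 5 * |z.re| := by linarith
    calc _ ≤ 2 * ((5 * |z.re|) * (A / (4 * |z.re|) * ‖c‖)) := by gcongr
      _ = 5 / 2 * A * ‖c‖ := by field_simp; ring
      _ ≤ _ := by
        have := mul_nonneg hA.le (norm_nonneg c)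
        linarith
  obtain ⟨y, hy⟩ : ∃ y : ℝ → ℂ × ℂ, y = fun x : ℝ =>
      (Complex.exp (-(Complex.I * z * x)) * (deriv (u z) x + Complex.I * z * u z x),
        Complex.exp (Complex.I * z * x) * (deriv (u z) x - Complex.I * z * u z x)) := ⟨_, rfl⟩
  have hsum : Summable fun n => a n * Complex.exp (-(A * L)) ^ n :=
    (summable_mul_pow hE hs0 (by
      rw [hwL]
      have := mul_nonneg hs0 (Real.exp_pos (-(A * L))).le
      linarith)).of_norm
  have hsum' : Summable fun n : ℕ =>
      ((Complex.I * z - n * A) * a n) * Complex.exp (-(A * L)) ^ n :=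
    (summable_mul_pow (norm_linear_mul_le hA.le _ hE) (by positivity) (by
      rw [hwL]
      linarith)).of_norm
  have hinv : Complex.exp (-(Complex.I * z * L)) * Complex.exp (Complex.I * z * L) = 1 := by
    rw [← Complex.exp_add, neg_add_cancel, Complex.exp_zero]
  have hy1 : (y L).1 =
      ∑' n : ℕ, ((2 * Complex.I * z - n * A) * a n) * Complex.exp (-(A * L)) ^ n := by
    have e : ∑' n : ℕ, ((2 * Complex.I * z - n * A) * a n) * Complex.exp (-(A * L)) ^ n =
        (∑' n : ℕ, ((Complex.I * z - n * A) * a n) * Complex.exp (-(A * L)) ^ n) +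
          Complex.I * z * ∑' n, a n * Complex.exp (-(A * L)) ^ n := by
      rw [← tsum_mul_left, ← hsum'.tsum_add (hsum.mul_left _)]
      exact tsum_congr fun n => by ring
    rw [e, hy]
    simp only [hv0, hv1, expSeries, ← ha]
    linear_combination ((∑' n : ℕ, ((Complex.I * z - n * A) * a n) *
      Complex.exp (-(A * L)) ^ n) + Complex.I * z * ∑' n, a n * Complex.exp (-(A * L)) ^ n) * hinv
  have hy2 : (y L).2 = Complex.exp (Complex.I * z * L) * (Complex.exp (Complex.I * z * L) *
      ∑' n : ℕ, ((0 - n * A) * a n) * Complex.exp (-(A * L)) ^ n) := by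
    have e : ∑' n : ℕ, ((0 - n * A) * a n) * Complex.exp (-(A * L)) ^ n =
        (∑' n : ℕ, ((Complex.I * z - n * A) * a n) * Complex.exp (-(A * L)) ^ n) -
          Complex.I * z * ∑' n, a n * Complex.exp (-(A * L)) ^ n := by
      rw [← tsum_mul_left, ← hsum'.tsum_sub (hsum.mul_left _)]
      exact tsum_congr fun n => by ring
    rw [e, hy]
    simp only [hv0, hv1, expSeries, ← ha]
    ring
  have h2z : ‖2 * Complex.I * z‖ = 2 * ‖z‖ := by
    rw [norm_mul, norm_mul, Complex.norm_I]
    simp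
  have hP := hser (2 * Complex.I * z) h2z.le
  rw [← hy1] at hP
  have hR : ‖(y L).2‖ ≤ Q * ‖c‖ := by
    have h0 := hser 0 (by simp)
    rw [zero_mul, sub_zero] at h0
    have he : ‖Complex.exp (Complex.I * z * L)‖ ≤ Real.exp L := by
      rw [Complex.norm_exp]
      refine Real.exp_le_exp.2 ?_
      have := (abs_le.1 him).1
      simp
      nlinarith
    have hexp := (Real.exp_pos L).le
    rw [hy2, norm_mul, norm_mul, hQ]
    calc _ ≤ Real.exp L * (Real.exp L * (5 * A * ‖c‖)) :=
          mul_le_mul he (mul_le_mul he h0 (norm_nonneg _) hexp) (by positivity) hexp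
      _ = _ := by ring
  have hyL : ‖y L‖ ≤ ‖z‖ * (2 + 5 * A + Q) * ‖c‖ := by
    have h1 : ‖(y L).1‖ ≤ 2 * ‖z‖ * ‖c‖ + 5 * A * ‖c‖ := by
      have h2 := norm_sub_norm_le (y L).1 (2 * Complex.I * z * c)
      rw [norm_mul, h2z] at h2
      linarith
    have hzc : ‖c‖ ≤ ‖z‖ * ‖c‖ := le_mul_of_one_le_left (norm_nonneg c) hz1
    have hAz := mul_le_mul_of_nonneg_left hzc (by positivity : 0 ≤ 5 * A)
    have hQz := mul_le_mul_of_nonneg_left hzc hQ0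
    have hzc0 : 0 ≤ ‖z‖ * ‖c‖ := by positivity
    have hzA : 0 ≤ 5 * A * (‖z‖ * ‖c‖) := by positivity
    have hzQ : 0 ≤ Q * (‖z‖ * ‖c‖) := by positivity
    rw [Prod.norm_def]
    refine max_le ?_ ?_ <;> linarith
  have hdiff : ‖y 0 - y L‖ ≤ T * ‖c‖ := by
    have h1 := (hu.outgoing z).1.norm_amplitude_sub_le hB hL.le him hz0 rfl hy
    rw [← hk] at h1
    have hkz : k / ‖z‖ ≤ k := div_le_self hk0 hz1
    calc _ ≤ _ := h1
      _ ≤ k / ‖z‖ * L * Real.exp (k * L) * (‖z‖ * (2 + 5 * A + Q) * ‖c‖) := by gcongr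
      _ = T * ‖c‖ := by
        rw [hT]
        field_simp
  have hd1 := (norm_fst_le _).trans hdiff
  have hd2 := (norm_snd_le _).trans hdiff
  rw [Prod.fst_sub] at hd1
  rw [Prod.snd_sub] at hd2
  have hy01 : (y 0).1 = deriv (u z) 0 + Complex.I * z * u z 0 := by simp [hy]
  have hy02 : (y 0).2 = deriv (u z) 0 - Complex.I * z * u z 0 := by simp [hy]
  rw [← hy01, ← hy02]
  have hn := norm_nonneg c
  have hAc := mul_nonneg hA.le hn
  have hQc := mul_nonneg hQ0 hn
  constructor
  · have := norm_add_le ((y 0).1 - (y L).1) ((y L).1 - 2 * Complex.I * z * c)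
    rw [sub_add_sub_cancel] at this
    linarith
  · have := norm_add_le ((y 0).2 - (y L).2) (y L).2
    rw [sub_add_cancel] at this
    linarith

/-! ### Counting the zeros of entire functions of finite order -/

section ZeroCounting

variable {F : ℂ → ℂ}

lemma Differentiable.analyticOrderAt_ne_top_of_ne_zero (hF : Differentiable ℂ F) {c : ℂ}
    (hc : F c ≠ 0) (z : ℂ) : analyticOrderAt F z ≠ ⊤ := by
  have han : AnalyticOnNhd ℂ F univ := fun z _ => hF.analyticAt z
  refine han.analyticOrderAt_ne_top_of_isPreconnected isPreconnected_univ (mem_univ c)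
    (mem_univ z) ?_
  rw [(hF.analyticAt c).analyticOrderAt_eq_zero.2 hc]
  exact ENat.zero_ne_top

lemma Differentiable.divisor_eq_analyticOrderNatAt (hF : Differentiable ℂ F) {c : ℂ}
    (hc : F c ≠ 0) {U : Set ℂ} {z : ℂ} (hz : z ∈ U) :
    MeromorphicOn.divisor F U z = analyticOrderNatAt F z := by
  have han : AnalyticOnNhd ℂ F U := fun z _ => hF.analyticAt z
  rw [MeromorphicOn.AnalyticOnNhd.divisor_apply han hz, ← Nat.cast_analyticOrderNatAt
    (hF.analyticOrderAt_ne_top_of_ne_zero hc z)]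
  simp

lemma Differentiable.one_le_analyticOrderNatAt (hF : Differentiable ℂ F) {c z : ℂ}
    (hc : F c ≠ 0) (hz : F z = 0) : 1 ≤ analyticOrderNatAt F z := by
  rw [Nat.one_le_iff_ne_zero]
  intro h
  have h1 := Nat.cast_analyticOrderNatAt (hF.analyticOrderAt_ne_top_of_ne_zero hc z)
  rw [h, Nat.cast_zero] at h1
  exact (hF.analyticAt z).analyticOrderAt_eq_zero.1 h1.symm hz

lemma Differentiable.zerosInDisc_subset_support_divisor (hF : Differentiable ℂ F) {c : ℂ}
    (hc : F c ≠ 0) {r R : ℝ} (h : r + ‖c‖ ≤ R) :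
    zerosInDisc F r ⊆ (MeromorphicOn.divisor F (Metric.closedBall c R)).support := by
  intro z hz
  have hmem : z ∈ Metric.closedBall c R := by
    rw [mem_closedBall_iff_norm]
    linarith [norm_sub_le z c, hz.2]
  rw [Function.mem_support, hF.divisor_eq_analyticOrderNatAt hc hmem]
  have := hF.one_le_analyticOrderNatAt hc hz.1
  exact_mod_cast (by omega : analyticOrderNatAt F z ≠ 0)

lemma Differentiable.finite_zerosInDisc (hF : Differentiable ℂ F) {c : ℂ} (hc : F c ≠ 0)
    (r : ℝ) : (zerosInDisc F r).Finite :=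
  ((MeromorphicOn.divisor F (Metric.closedBall c (r + ‖c‖))).finiteSupport
    (isCompact_closedBall _ _)).subset (hF.zerosInDisc_subset_support_divisor hc le_rfl)

/-- Jensen's inequality for the number of zeros, counted with multiplicity. -/
lemma Differentiable.finsum_analyticOrderNatAt_le (hF : Differentiable ℂ F) {c : ℂ}
    (hc : F c ≠ 0) {r M : ℝ} (hr : 0 < r) (hM : 1 ≤ M)
    (hb : ∀ z, ‖z‖ ≤ 3 * ‖c‖ + 2 * r → ‖F z‖ ≤ M) :
    ∑ᶠ z ∈ zerosInDisc F r, (analyticOrderNatAt F z : ℝ) ≤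
      Real.log (M / ‖F c‖) / Real.log 2 := by
  obtain ⟨R, hR⟩ : ∃ R, R = r + ‖c‖ := ⟨_, rfl⟩
  have hR0 : 0 < R := by rw [hR]; positivity
  have hJ := AnalyticOnNhd.sum_divisor_le (c := c) (r := R) (R := 2 * R) (f := F)
    (by rw [abs_of_pos hR0]; exact hR0)
    (by rw [abs_of_pos hR0, abs_of_pos (by positivity)]; linarith) hM
    (fun z _ => hF.analyticAt z) hc (fun z hz => hb z (by
      rw [abs_of_pos (by positivity), mem_sphere_iff_norm] at hz
      have := norm_sub_norm_le z c
      rw [hz] at this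
      linarith))
  rw [mul_div_assoc, div_self hR0.ne', mul_one, abs_of_pos hR0] at hJ
  refine le_trans ?_ hJ
  have hsub := hF.zerosInDisc_subset_support_divisor hc (r := r) hR.ge
  have hfin := (MeromorphicOn.divisor F (Metric.closedBall c R)).finiteSupport
    (isCompact_closedBall _ _)
  have han : AnalyticOnNhd ℂ F (Metric.closedBall c R) := fun z _ => hF.analyticAt z
  have hZ := hfin.subset hsub
  rw [finsum_mem_eq_finite_toFinset_sum _ hZ,
    finsum_eq_sum_of_support_subset (s := hfin.toFinset) _ (by simp)]
  push_cast
  refine le_trans (le_of_eq ?_) (Finset.sum_le_sum_of_subset_of_nonneg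
    ((Set.Finite.toFinset_subset_toFinset (hs := hZ)).2 hsub) fun z _ _ => ?_)
  · refine Finset.sum_congr rfl fun z hz => ?_
    have hz' := (Set.Finite.mem_toFinset hZ).1 hz
    rw [hF.divisor_eq_analyticOrderNatAt hc]
    · simp
    · rw [mem_closedBall_iff_norm]
      linarith [norm_sub_le z c, hz'.2]
  · exact_mod_cast MeromorphicOn.AnalyticOnNhd.divisor_nonneg han z

lemma Differentiable.ncard_zerosInDisc_le (hF : Differentiable ℂ F) {c : ℂ} (hc : F c ≠ 0)
    (r : ℝ) : ((zerosInDisc F r).ncard : ℝ) ≤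
      ∑ᶠ z ∈ zerosInDisc F r, (analyticOrderNatAt F z : ℝ) := by
  have hZ := hF.finite_zerosInDisc hc r
  rw [finsum_mem_eq_finite_toFinset_sum _ hZ, Set.ncard_eq_toFinset_card _ hZ,
    Finset.cast_card]
  refine Finset.sum_le_sum fun z hz => ?_
  exact_mod_cast hF.one_le_analyticOrderNatAt hc ((Set.Finite.mem_toFinset hZ).1 hz).1

/-- Entire functions of order at most one have `O (r ^ (1 + ε))` zeros in the disc of radius `r`. -/
theorem Differentiable.exists_zerosInDisc_le (hF : Differentiable ℂ F) {c : ℂ} (hc : F c ≠ 0)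
    (hgrowth : ∀ p : ℝ, 1 < p → p ≤ 2 →
      ∃ C : ℝ, 0 ≤ C ∧ ∀ z, ‖F z‖ ≤ Real.exp (C * (1 + ‖z‖) ^ p)) {ε : ℝ} (hε : 0 < ε) :
    ∃ C : ℝ, 0 < C ∧ ∀ r : ℝ, 0 < r → (zerosInDisc F r).Finite ∧
      ((zerosInDisc F r).ncard : ℝ) ≤ C * (1 + r ^ (1 + ε)) ∧
      ∑ᶠ z ∈ zerosInDisc F r, (analyticOrderNatAt F z : ℝ) ≤ C * (1 + r ^ (1 + ε)) := by
  obtain ⟨p, hp⟩ : ∃ p, p = min (1 + ε) 2 := ⟨_, rfl⟩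
  have hp1 : 1 < p := by rw [hp]; exact lt_min (by linarith) one_lt_two
  have hp2 : p ≤ 2 := by rw [hp]; exact min_le_right _ _
  have hpε : p ≤ 1 + ε := by rw [hp]; exact min_le_left _ _
  obtain ⟨C, hC, hb⟩ := hgrowth p hp1 hp2
  have hFc : 0 < ‖F c‖ := norm_pos_iff.2 hc
  have hlog2 : 0 < Real.log 2 := Real.log_pos one_lt_two
  obtain ⟨K, hK⟩ : ∃ K, K = 3 + 3 * ‖c‖ := ⟨_, rfl⟩
  have hK0 : 0 ≤ K := by rw [hK]; positivity
  obtain ⟨T, hT⟩ : ∃ T, T = (C * K ^ p + |Real.log ‖F c‖|) / Real.log 2 + 1 := ⟨_, rfl⟩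
  have hT0 : 0 < T := by rw [hT]; positivity
  refine ⟨T, hT0, fun r hr => ?_⟩
  have hrpow : 0 ≤ r ^ (1 + ε) := by positivity
  have hmax : (max 1 r) ^ p ≤ 1 + r ^ (1 + ε) := by
    rcases le_total r 1 with h | h
    · rw [max_eq_left h, Real.one_rpow]
      linarith
    · rw [max_eq_right h]
      have := Real.rpow_le_rpow_of_exponent_le h hpε
      linarith
  have hbase : 1 + (3 * ‖c‖ + 2 * r) ≤ K * max 1 r := by
    have h1 := le_max_left 1 r
    have h2 := le_max_right 1 r
    rw [hK]
    nlinarith [norm_nonneg c]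
  have hsum : ∑ᶠ z ∈ zerosInDisc F r, (analyticOrderNatAt F z : ℝ) ≤ T * (1 + r ^ (1 + ε)) := by
    have hM : ∀ z, ‖z‖ ≤ 3 * ‖c‖ + 2 * r →
        ‖F z‖ ≤ Real.exp (C * K ^ p * (1 + r ^ (1 + ε))) := fun z hz => by
      refine (hb z).trans (Real.exp_le_exp.2 ?_)
      rw [mul_assoc]
      refine mul_le_mul_of_nonneg_left ?_ hC
      calc (1 + ‖z‖) ^ p ≤ (K * max 1 r) ^ p := by
            gcongr
            linarith
        _ = K ^ p * (max 1 r) ^ p := Real.mul_rpow hK0 (by positivity)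
        _ ≤ _ := by gcongr
    refine (hF.finsum_analyticOrderNatAt_le hc hr (Real.one_le_exp (by positivity)) hM).trans ?_
    rw [Real.log_div (Real.exp_ne_zero _) hFc.ne', Real.log_exp, div_le_iff₀ hlog2, hT]
    have h1 := neg_abs_le (Real.log ‖F c‖)
    have h2 : 0 ≤ |Real.log ‖F c‖| * r ^ (1 + ε) := by positivity
    have h3 : ((C * K ^ p + |Real.log ‖F c‖|) / Real.log 2 + 1) * (1 + r ^ (1 + ε)) *
        Real.log 2 = (C * K ^ p + |Real.log ‖F c‖|) * (1 + r ^ (1 + ε)) +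
          (1 + r ^ (1 + ε)) * Real.log 2 := by
      field_simp
    have h4 : 0 ≤ (1 + r ^ (1 + ε)) * Real.log 2 := by positivity
    rw [h3]
    linarith
  exact ⟨hF.finite_zerosInDisc hc r, (hF.ncard_zerosInDisc_le hc r).trans hsum, hsum⟩

end ZeroCounting

/-! ### The Wronskian of the two outgoing families -/

lemma Continuous.exists_abs_le_of_tendsto {V : ℝ → ℝ} (hV : Continuous V) {a b : ℝ}
    (ht : Tendsto V atTop (𝓝 a)) (hb : Tendsto V atBot (𝓝 b)) : ∃ B, ∀ x, |V x| ≤ B := by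
  obtain ⟨N, hN⟩ := eventually_atTop.1 (ht.abs.eventually_le_const (lt_add_one |a|))
  obtain ⟨N', hN'⟩ := eventually_atBot.1 (hb.abs.eventually_le_const (lt_add_one |b|))
  obtain ⟨C, hC⟩ := (isCompact_Icc (a := N') (b := N)).exists_bound_of_continuousOn
    hV.continuousOn
  refine ⟨max C (max (|a| + 1) (|b| + 1)), fun x => ?_⟩
  rcases le_total N x with h | h
  · exact (hN x h).trans ((le_max_left _ _).trans (le_max_right _ _))
  rcases le_total x N' with h' | h'
  · exact (hN' x h').trans ((le_max_right _ _).trans (le_max_right _ _))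
  · exact (hC x ⟨h', h⟩).trans (le_max_left _ _)

lemma tendsto_zero_of_expansion {V : ℝ → ℝ} {A R : ℝ} (hA : 0 < A) {F : ℂ → ℂ}
    (hF : AnalyticAt ℂ F 0) (h0 : F 0 = 0)
    (h : ∀ x : ℝ, R < x → (V x : ℂ) = F (Complex.exp (-(A * x)))) :
    Tendsto V atTop (𝓝 0) := by
  have h1 : Tendsto (fun x : ℝ => F (Complex.exp (-(A * x)))) atTop (𝓝 0) := by
    rw [← h0]
    exact hF.continuousAt.tendsto.comp (tendsto_exp_neg_mul_atTop hA)
  have h2 := (Complex.continuous_re.tendsto 0).comp h1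
  refine h2.congr' ?_
  filter_upwards [eventually_gt_atTop R] with x hx
  simp [← h x hx]

lemma IsExpAnalyticPotential.atTop_and_atBot {V : ℝ → ℝ} {Aplus Aminus : ℝ}
    (h : IsExpAnalyticPotential V Aplus Aminus) :
    IsExpAnalyticAtTop V Aplus ∧ IsExpAnalyticAtTop (fun x => V (-x)) Aminus := by
  obtain ⟨R, -, F, G, hF, hF0, hG, hG0, hVF, hVG⟩ := h.expansion
  have hc := h.smooth.continuous
  have hVG' : ∀ x : ℝ, R < x → (V (-x) : ℂ) = G (Complex.exp (-(Aminus * x))) := fun x hx => by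
    rw [hVG (-x) (by linarith)]
    simp
  have ht := tendsto_zero_of_expansion h.plus_pos hF hF0 hVF
  have hb : Tendsto V atBot (𝓝 0) := by
    have := (tendsto_zero_of_expansion h.minus_pos hG hG0 hVG').comp tendsto_neg_atBot_atTop
    exact this.congr fun x => by simp
  obtain ⟨B, hB⟩ := hc.exists_abs_le_of_tendsto ht hb
  exact ⟨⟨h.plus_pos, hc, ⟨B, hB⟩, R, F, hF, hF0, hVF⟩,
    ⟨h.minus_pos, hc.comp continuous_neg, ⟨B, fun x => hB (-x)⟩, R, G, hG, hG0, hVG'⟩⟩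

section Wronskian

variable {V : ℝ → ℝ} {A A' : ℝ} {u v : ℂ → ℝ → ℂ}

lemma SolvesSchrodinger.wronskianAt_comp_neg {lam : ℂ} {u v : ℝ → ℂ}
    (hv : SolvesSchrodinger (fun x => V (-x)) lam v) :
    wronskianAt u (fun x => v (-x)) 0 = deriv u 0 * v 0 + u 0 * deriv v 0 := by
  have h1 : HasDerivAt (fun x : ℝ => v (-x)) (-deriv v 0) 0 := by
    have h2 := hv.hasDerivAt (-0)
    rw [neg_zero] at h2
    have h3 := HasDerivAt.scomp (0 : ℝ) (by rwa [neg_zero]) (hasDerivAt_neg (0 : ℝ)) (g₁ := v)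
      (g₁' := deriv v 0)
    simpa [Function.comp_def] using h3
  rw [wronskianAt, h1.deriv, neg_zero]
  ring

lemma IsOutgoingFamilyPlus.exists_eq_I_mul_of_wronskian_eq_zero (hV : IsExpAnalyticAtTop V A)
    (hV' : IsExpAnalyticAtTop (fun x => V (-x)) A') (hu : IsOutgoingFamilyPlus V A u)
    (hv : IsOutgoingFamilyPlus (fun x => V (-x)) A' v) :
    ∃ C : ℝ, 0 < C ∧ ∀ lam : ℂ, 0 ≤ lam.im →
      deriv (u lam) 0 * v lam 0 + u lam 0 * deriv (v lam) 0 = 0 →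
      ∃ y ∈ Set.Icc (0 : ℝ) C, lam = Complex.I * y := by
  obtain ⟨B, hB⟩ := hV.bounded
  have hB0 : 0 ≤ B := (abs_nonneg _).trans (hB 0)
  refine ⟨B + 1, by linarith, fun lam hlam h0 => ?_⟩
  have hc : (Complex.Gamma (1 - 2 * Complex.I * lam / A))⁻¹ ≠ 0 :=
    inv_Gamma_ne_zero hV.pos (by linarith [hV.pos])
  have hc' : (Complex.Gamma (1 - 2 * Complex.I * lam / A'))⁻¹ ≠ 0 :=
    inv_Gamma_ne_zero hV'.pos (by linarith [hV'.pos])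
  have hvs := (hv.outgoing lam).1
  obtain ⟨x₁, hx₁⟩ := (((hv.outgoing lam).tendsto hV'.pos).1.eventually_ne hc').exists
  have hvn : SolvesSchrodinger V lam fun x => v lam (-x) := by simpa using hvs.comp_neg
  obtain ⟨k, hk⟩ := (hu.outgoing lam).1.eq_const_mul hV.continuous hB hvn (x₁ := -x₁)
    (by simpa using right_ne_zero_of_mul hx₁) (x₀ := 0)
    (by rw [hvs.wronskianAt_comp_neg, h0])
  exact exists_eq_I_mul_of_outgoing hB hV.pos hV'.pos hc (hu.outgoing lam) (hv.outgoing lam) hk hlam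

lemma IsOutgoingFamilyPlus.exists_norm_wronskian_le (hV : IsExpAnalyticAtTop V A)
    (hV' : IsExpAnalyticAtTop (fun x => V (-x)) A') (hu : IsOutgoingFamilyPlus V A u)
    (hv : IsOutgoingFamilyPlus (fun x => V (-x)) A' v) {p : ℝ} (hp1 : 1 < p) (hp2 : p ≤ 2) :
    ∃ C : ℝ, 0 ≤ C ∧ ∀ z : ℂ, ‖deriv (u z) 0 * v z 0 + u z 0 * deriv (v z) 0‖ ≤
      Real.exp (C * (1 + ‖z‖) ^ p) := by
  obtain ⟨C, hC, h1⟩ := hu.exists_norm_le hV hp1 hp2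
  obtain ⟨D, hD, h2⟩ := hv.exists_norm_le hV' hp1 hp2
  refine ⟨C + D + 1, by positivity, fun z => ?_⟩
  obtain ⟨a0, a1⟩ := h1 z
  obtain ⟨b0, b1⟩ := h2 z
  have hX : 1 ≤ (1 + ‖z‖) ^ p :=
    Real.one_le_rpow (by linarith [norm_nonneg z]) (by linarith)
  have h3 := mul_le_mul a1 b0 (norm_nonneg _) (Real.exp_pos _).le
  have h4 := mul_le_mul a0 b1 (norm_nonneg _) (Real.exp_pos _).le
  have h5 : 2 ≤ Real.exp ((1 + ‖z‖) ^ p) := by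
    linarith [Real.add_one_le_exp ((1 + ‖z‖) ^ p)]
  rw [← Real.exp_add] at h3 h4
  calc _ ≤ _ := norm_add_le _ _
    _ ≤ 2 * Real.exp (C * (1 + ‖z‖) ^ p + D * (1 + ‖z‖) ^ p) := by
      rw [norm_mul, norm_mul]
      linarith
    _ ≤ Real.exp ((1 + ‖z‖) ^ p) * Real.exp (C * (1 + ‖z‖) ^ p + D * (1 + ‖z‖) ^ p) := by
      gcongr
    _ = _ := by
      rw [← Real.exp_add]
      ring_nf

/-- The Wronskian `F` does not vanish at high energy in a strip. With `p = u' + i lam u` and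
`q = u' - i lam u` for either family, `2 i lam F = p₊ p₋ - q₊ q₋`, and `p±` dominate. -/
lemma IsOutgoingFamilyPlus.exists_wronskian_ne_zero (hV : IsExpAnalyticAtTop V A)
    (hV' : IsExpAnalyticAtTop (fun x => V (-x)) A') (hu : IsOutgoingFamilyPlus V A u)
    (hv : IsOutgoingFamilyPlus (fun x => V (-x)) A' v) :
    ∃ δ C : ℝ, 0 < δ ∧ ∀ z : ℂ, -δ < z.im → z.im < 0 → C ≤ |z.re| →
      deriv (u z) 0 * v z 0 + u z 0 * deriv (v z) 0 ≠ 0 := by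
  obtain ⟨C, hC, h1⟩ := hu.exists_norm_amplitude_le hV
  obtain ⟨D, hD, h2⟩ := hv.exists_norm_amplitude_le hV'
  refine ⟨min 1 (min (A / 2) (A' / 2)), C + D + 1,
    lt_min one_pos (lt_min (half_pos hV.pos) (half_pos hV'.pos)), fun z hz hz0 hre h0 => ?_⟩
  have hz1 : -1 < z.im := by linarith [min_le_left 1 (min (A / 2) (A' / 2))]
  have hzA : -(A / 2) < z.im := by
    have := (min_le_right 1 (min (A / 2) (A' / 2))).trans (min_le_left _ _)
    linarith
  have hzA' : -(A' / 2) < z.im := by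
    have := (min_le_right 1 (min (A / 2) (A' / 2))).trans (min_le_right _ _)
    linarith
  have him : |z.im| ≤ 1 := abs_le.2 ⟨hz1.le, by linarith⟩
  have hc := norm_pos_iff.2 (inv_Gamma_ne_zero hV.pos hzA)
  have hd := norm_pos_iff.2 (inv_Gamma_ne_zero hV'.pos hzA')
  obtain ⟨p1, q1⟩ := h1 z _ rfl him (by linarith)
  obtain ⟨p2, q2⟩ := h2 z _ rfl him (by linarith)
  set c := (Complex.Gamma (1 - 2 * Complex.I * z / A))⁻¹
  set d := (Complex.Gamma (1 - 2 * Complex.I * z / A'))⁻¹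
  have hnz : C + D + 1 ≤ ‖z‖ := hre.trans (Complex.abs_re_le_norm z)
  have h2z : ‖2 * Complex.I * z‖ = 2 * ‖z‖ := by
    rw [norm_mul, norm_mul, Complex.norm_I]
    simp
  have hid : (deriv (u z) 0 + Complex.I * z * u z 0) * (deriv (v z) 0 + Complex.I * z * v z 0) =
      (deriv (u z) 0 - Complex.I * z * u z 0) * (deriv (v z) 0 - Complex.I * z * v z 0) := by
    linear_combination (2 * Complex.I * z) * h0
  have hp : ∀ {a b : ℂ} {E : ℝ}, 0 < ‖b‖ → E < ‖z‖ → ‖a - 2 * Complex.I * z * b‖ ≤ E * ‖b‖ →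
      E * ‖b‖ < ‖a‖ := by
    intro a b E hb hE hab
    have h3 := norm_sub_norm_le (2 * Complex.I * z * b) a
    rw [norm_sub_rev, norm_mul, h2z] at h3
    have := mul_lt_mul_of_pos_right hE hb
    linarith
  have hp1 := hp hc (by linarith) p1
  have hp2 := hp hd (by linarith) p2
  have h3 := congrArg norm hid
  rw [norm_mul, norm_mul] at h3
  have h4 := mul_lt_mul'' hp1 hp2 (by positivity) (by positivity)
  have h5 := mul_le_mul q1 q2 (norm_nonneg _) (by positivity)
  linarith

open ComplexConjugate in
lemma IsOutgoingFamilyPlus.deriv_conj (hV : IsExpAnalyticAtTop V A)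
    (hu : IsOutgoingFamilyPlus V A u) (z : ℂ) (x : ℝ) :
    deriv (u z) x = conj (deriv (u (-conj z)) x) := by
  have h1 := Complex.conjCLE.hasFDerivAt.comp_hasDerivAt x
    ((hu.outgoing (-conj z)).1.hasDerivAt x)
  have e : u z = fun x => conj (u (-conj z) x) := funext fun x => hu.conj hV z x
  conv_lhs => rw [e]
  exact h1.deriv

end Wronskian

theorem mainTheorem8 (V : ℝ → ℝ) (Aplus Aminus : ℝ)
    (hV : IsExpAnalyticPotential V Aplus Aminus) :
    -- the outgoing families exist and are uniquely determined
    (∃! u : ℂ → ℝ → ℂ, IsOutgoingFamilyPlus V Aplus u) ∧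
    (∃! u : ℂ → ℝ → ℂ, IsOutgoingFamilyMinus V Aminus u) ∧
    ∀ uplus uminus : ℂ → ℝ → ℂ,
      IsOutgoingFamilyPlus V Aplus uplus → IsOutgoingFamilyMinus V Aminus uminus →
      -- their Wronskian does not depend on `x` and is an entire function `F`
      ∃ F : ℂ → ℂ,
        (∀ (lam : ℂ) (x : ℝ), wronskianAt (uplus lam) (uminus lam) x = F lam) ∧
        Differentiable ℂ F ∧
        -- location of the zeros
        (∃ C : ℝ, 0 < C ∧ ∀ lam : ℂ, F lam = 0 →
          (∃ y ∈ Set.Icc (0 : ℝ) C, lam = Complex.I * y) ∨ lam.im < 0) ∧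
        {lam : ℂ | F lam = 0 ∧ 0 ≤ lam.im}.Finite ∧
        -- symmetry
        (∀ lam : ℂ, F lam = 0 → F (-(starRingEnd ℂ) lam) = 0) ∧
        (∀ lam : ℂ, F lam = (starRingEnd ℂ) (F (-(starRingEnd ℂ) lam))) ∧
        -- zero-free strip
        (∃ δ : ℝ, 0 < δ ∧ ∀ lam : ℂ, -δ < lam.im → lam.im < 0 → F lam ≠ 0) ∧
        -- number of zeros, without and with multiplicity
        (∀ ε : ℝ, 0 < ε → ∃ C : ℝ, 0 < C ∧ ∀ r : ℝ, 0 < r →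
          (zerosInDisc F r).Finite ∧
          ((zerosInDisc F r).ncard : ℝ) ≤ C * (1 + r ^ (1 + ε)) ∧
          ∑ᶠ z ∈ zerosInDisc F r, (analyticOrderNatAt F z : ℝ) ≤ C * (1 + r ^ (1 + ε))) := by
  obtain ⟨hp, hm⟩ := hV.atTop_and_atBot
  refine ⟨?_, ?_, fun u um hu hum => ?_⟩
  · obtain ⟨u, -, -, -, -, -, hu, -⟩ := hp.exists_family
    exact ⟨u, hu, fun v hv => hv.unique hp hu⟩
  · obtain ⟨u, -, -, -, -, -, hu, -⟩ := hm.exists_family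
    refine ⟨fun z x => u z (-x), isOutgoingFamilyMinus_iff.2 (by simpa using hu), fun v hv => ?_⟩
    have := (isOutgoingFamilyMinus_iff.1 hv).unique hm hu
    ext z x
    simp [← this]
  obtain ⟨v, hv_def⟩ : ∃ v : ℂ → ℝ → ℂ, v = fun z x => um z (-x) := ⟨_, rfl⟩
  have hv : IsOutgoingFamilyPlus (fun x => V (-x)) Aminus v := by
    rw [hv_def]
    exact isOutgoingFamilyMinus_iff.1 hum
  have humv : ∀ z, um z = fun x => v z (-x) := fun z => by simp [hv_def]
  obtain ⟨F, hF⟩ : ∃ F : ℂ → ℂ,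
      F = fun z => deriv (u z) 0 * v z 0 + u z 0 * deriv (v z) 0 := ⟨_, rfl⟩
  have hFz : ∀ z, F z = deriv (u z) 0 * v z 0 + u z 0 * deriv (v z) 0 := fun z => by rw [hF]
  have hFd : Differentiable ℂ F := by
    rw [hF]
    exact ((hu.differentiable_deriv hp 0).mul (hv.entire 0)).add
      ((hu.entire 0).mul (hv.differentiable_deriv hm 0))
  obtain ⟨C, hC, hloc⟩ := hu.exists_eq_I_mul_of_wronskian_eq_zero hp hm hv
  simp_rw [← hFz] at hloc
  have hF1 : F 1 ≠ 0 := fun h => by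
    obtain ⟨y, -, hy⟩ := hloc 1 (by simp) h
    simpa using congrArg Complex.re hy
  have hsymm : ∀ lam : ℂ, F lam = (starRingEnd ℂ) (F (-(starRingEnd ℂ) lam)) := fun lam => by
    rw [hFz, hFz, hu.deriv_conj hp, hv.deriv_conj hm, hu.conj hp lam, hv.conj hm lam]
    simp
  refine ⟨F, fun lam x => ?_, hFd, ⟨C, hC, fun lam h => ?_⟩, ?_, fun lam h => ?_, hsymm, ?_,
    fun ε hε => hFd.exists_zerosInDisc_le hF1 (fun p hp1 hp2 => ?_) hε⟩
  · rw [(hu.outgoing lam).1.wronskianAt_eq (hum.outgoing lam).1 x 0, humv, hFz,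
      (hv.outgoing lam).1.wronskianAt_comp_neg]
  · rcases lt_or_ge lam.im 0 with him | him
    · exact Or.inr him
    · exact Or.inl (hloc lam him h)
  · refine (hFd.finite_zerosInDisc hF1 C).subset fun lam h => ⟨h.1, ?_⟩
    obtain ⟨y, hy, rfl⟩ := hloc lam h.2 h.1
    simpa [abs_of_nonneg hy.1] using hy.2
  · have := hsymm lam
    rw [h] at this
    simpa using this.symm
  · obtain ⟨δ, D, hδ, hne⟩ := hu.exists_wronskian_ne_zero hp hm hv
    simp_rw [← hFz] at hne
    -- Only finitely many zeros in the strip `-δ < Im < 0` have `|Re| < D`.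
    have hfin := hFd.finite_zerosInDisc hF1 (D + δ)
    have hev : ∀ᶠ d : ℝ in 𝓝[>] 0, ∀ z ∈ zerosInDisc F (D + δ), z.im < 0 → d < -z.im := by
      rw [eventually_all_finite hfin]
      intro z _
      rcases lt_or_ge z.im 0 with him | him
      · filter_upwards [nhdsWithin_le_nhds (Iio_mem_nhds (neg_pos.2 him))] with d hd _
        exact hd
      · exact Eventually.of_forall fun d h => absurd h (not_lt.2 him)
    obtain ⟨d, hd, hd0⟩ := (hev.and eventually_mem_nhdsWithin).exists
    refine ⟨min d δ, lt_min hd0 hδ, fun z hz hz0 h => ?_⟩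
    have h1 := min_le_left d δ
    have h2 := min_le_right d δ
    have hre : |z.re| < D := by
      by_contra! hre
      exact hne z (by linarith) hz0 hre h
    have := hd z ⟨h, ?_⟩ hz0
    · linarith
    · have := Complex.norm_le_abs_re_add_abs_im z
      rw [abs_of_neg hz0] at this
      linarith
  · simp_rw [hFz]
    exact hu.exists_norm_wronskian_le hp hm hv hp1 hp2
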